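/- Let $\mathbf k$ be a field. A \emph{solution} is a pair $(X,r)$ of a nonempty set $X$ and a map $r:X\times X\to X\times X$, $r(x,y)=({}^xy,x^y)$, that is involutive ($r^2=\mathrm{id}$), nondegenerate (all maps $y\mapsto {}^xy$ and $y\mapsto y^x$ are bijective) and satisfies the braid relation $r^{12}r^{23}r^{12}=r^{23}r^{12}r^{23}$ on $X^3$. Its Yang--Baxter algebra is $\mathcal A_X=\mathcal A(\mathbf k,X,r)=\mathbf k\langle X\rangle/I$, where $I$ is the two-sided ideal generated by all $xy-y'x'$ with $r(x,y)=(y',x')\ne(x,y)$; it is graded by length, and $\mathcal A_X^{(d)}=\bigoplus_{m\ge 0}(\mathcal A_X)_{md}$ is its $d$-Veronese subalgebra. Let $(X,r)$ be a solution of finite order $n\ge 1$ with an enumeration $X=\{x_1<\dots<x_n\}$, and order words in $X$ degree-lexicographically. A word is \emph{normal} if it contains no leading monomial $\mathbf{LM}(f)$, $0\neq f\in I$, as a subword; $\mathcal N_m$ denotes the set of normal words of length $m$, and $\mathrm{Nor}(w)$ is the unique normal word equal to the word $w$ in $\mathcal A_X$. The actions ${}^xy$, $x^y$ extend to words by ${}^{ab}u={}^a({}^bu)$,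 ${}^a(uv)=({}^au)({}^{a^u}v)$, $a^{uv}=(a^u)^v$, $(ab)^u=(a^{{}^bu})(b^u)$. Let $d\ge 2$, let $N=\binom{n+d-1}{d}$, and define $\rho(a,b)=(\mathrm{Nor}({}^ab),\mathrm{Nor}(a^b))$ for $a,b\in\mathcal N_d$. Then $\mathcal N_d$ has exactly $N$ elements $w_1<\dots<w_N$ (in lexicographic order), and on $Y=\{y_1<\dots<y_N\}$ the rule $$r_Y(y_j,y_i)=(y_{i'},y_{j'})\iff\rho(w_j,w_i)=(w_{i'},w_{j'})$$ defines a solution $(Y,r_Y)$, the \emph{$d$-Veronese solution}; let $\mathcal A_Y=\mathcal A(\mathbf k,Y,r_Y)$. Put $$\mathrm P(n,d)=\{(i,j): a'b'\ge w_iw_j,\ \text{where }(a',b')=\rho(w_i,w_j)\},$$ $$\mathrm C(n,d)=\{(i,j)\in\mathrm P(n,d): w_iw_j\in\mathcal N_{2d}\},\qquad \mathrm{MV}(n,d)=\{(i,j)\in\mathrm P(n,d): w_iw_j\notin\mathcal N_{2d}\}.$$ \textbf{Theorem.} The assignment $y_i\mapsto w_i$ $(1\le i\le N)$ extends to an algebra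 homomorphism $v_{n,d}:\mathcal A_Y\to\mathcal A_X$, and: (1) The image of $v_{n,d}$ is the $d$-Veronese subalgebra $\mathcal A_X^{(d)}$. (2) For each $(i,j)\in\mathrm{MV}(n,d)$ there is a unique $(i_0,j_0)\in\mathrm C(n,d)$ such that $w_{i_0}w_{j_0}=\mathrm{Nor}(w_iw_j)$. The kernel of $v_{n,d}$ is generated, as a two-sided ideal, by the set $$\mathcal R_Y^{\mathrm v}=\{\gamma_{ij}=y_iy_j-y_{i_0}y_{j_0} : (i,j)\in\mathrm{MV}(n,d)\}\subset \mathcal A_Y,$$ which consists of exactly $|\mathrm{MV}(n,d)|=\binom{N+1}{2}-\binom{n+2d-1}{n-1}$ quadratic binomials that are linearly independent over $\mathbf k$. It is a minimal set of generators: no proper subset of it generates the kernel. Moreover, as polynomials in $\mathbf k\langle Y\rangle$ with the degree-lexicographic order, $\mathbf{LM}(\gamma_{ij})=y_iy_j>y_{i_0}y_{j_0}$. -/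

import Mathlib

/-! ### Set-theoretic solutions of the Yang–Baxter equation -/

/-- `r₁₂ = r × id` on `X × X × X`. -/
def braid12 {X : Type*} (r : X × X → X × X) (t : X × X × X) : X × X × X :=
  ((r (t.1, t.2.1)).1, (r (t.1, t.2.1)).2, t.2.2)

/-- `r₂₃ = id × r` on `X × X × X`. -/
def braid23 {X : Type*} (r : X × X → X × X) (t : X × X × X) : X × X × X :=
  (t.1, r t.2)

/-- A *solution*: a nondegenerate symmetric set `(X, r)`, where `r (x, y) = (ˣy, xʸ)`. -/
structure IsSolution {X : Type*} (r : X × X → X × X) : Prop where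
  involutive : Function.Involutive r
  left_nondegenerate : ∀ x, Function.Bijective fun y => (r (x, y)).1
  right_nondegenerate : ∀ y, Function.Bijective fun x => (r (x, y)).2
  braid : braid12 r ∘ braid23 r ∘ braid12 r = braid23 r ∘ braid12 r ∘ braid23 r

/-! ### The Yang–Baxter algebra `A(k, X, r) = k⟨X⟩ / (ℜ₀)` -/

/-- The free associative algebra `k⟨X⟩`, with its basis of words. -/
abbrev FreeAlg (k X : Type*) [Field k] : Type _ := MonoidAlgebra k (FreeMonoid X)

/-- A word in the alphabet `X`, as an element of `k⟨X⟩`. -/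
noncomputable def wordPoly (k : Type*) {X : Type*} [Field k] (u : List X) : FreeAlg k X :=
  MonoidAlgebra.single (FreeMonoid.ofList u) 1

/-- The set `ℜ₀` of the quadratic relations `xy - y'x'`, where `r (x, y) = (y', x') ≠ (x, y)`. -/
def ybRelations (k : Type*) {X : Type*} [Field k] (r : X × X → X × X) : Set (FreeAlg k X) :=
  {f | ∃ x y y' x', r (x, y) = (y', x') ∧ (x, y) ≠ (y', x') ∧
    f = wordPoly k [x, y] - wordPoly k [y', x']}

/-- The two-sided ideal `(ℜ₀)` of `k⟨X⟩`. -/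
noncomputable def ybIdeal (k : Type*) {X : Type*} [Field k] (r : X × X → X × X) : TwoSidedIdeal (FreeAlg k X) :=
  TwoSidedIdeal.span (ybRelations k r)

/-- The Yang–Baxter algebra `A(k, X, r)`. -/
abbrev YBAlgebra (k : Type*) {X : Type*} [Field k] (r : X × X → X × X) : Type _ :=
  (ybIdeal k r).ringCon.Quotient

/-- The image in `A(k, X, r)` of a word. -/
noncomputable def ybWord (k : Type*) {X : Type*} [Field k] (r : X × X → X × X) (u : List X) :
    YBAlgebra k r :=
  (ybIdeal k r).ringCon.mk' (wordPoly k u)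

/-- The homogeneous component `A_m` of `A(k, X, r)`, spanned by the words of length `m`. -/
noncomputable def ybComponent (k : Type*) {X : Type*} [Field k] (r : X × X → X × X) (m : ℕ) :
    Submodule k (YBAlgebra k r) :=
  Submodule.span k {a | ∃ u : List X, u.length = m ∧ a = ybWord k r u}

theorem wordPoly_append (k : Type*) {X : Type*} [Field k] (u v : List X) :
    wordPoly k (u ++ v) = wordPoly k u * wordPoly k v := by
  simp [wordPoly, MonoidAlgebra.single_mul_single]

theorem ybWord_append (k : Type*) {X : Type*} [Field k] (r : X × X → X × X) (u v : List X) :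
    ybWord k r (u ++ v) = ybWord k r u * ybWord k r v := by
  simp only [ybWord, wordPoly_append, map_mul]

theorem ybComponent_mul_le (k : Type*) {X : Type*} [Field k] (r : X × X → X × X) (p q : ℕ) :
    ybComponent k r p * ybComponent k r q ≤ ybComponent k r (p + q) := by
  rw [ybComponent, ybComponent, Submodule.span_mul_span, Submodule.span_le]
  rintro _ ⟨_, ⟨u, hu, rfl⟩, _, ⟨v, hv, rfl⟩, rfl⟩
  exact Submodule.subset_span ⟨u ++ v, by simp [hu, hv], (ybWord_append k r u v).symm⟩

/-- The `d`-Veronese subalgebra `A^{(d)} = ⨁ₘ A_{md}` of `A = A(k, X, r)`. -/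
noncomputable def veroneseSubalgebra (k : Type*) {X : Type*} [Field k] (r : X × X → X × X) (d : ℕ) :
    Subalgebra k (YBAlgebra k r) :=
  Submodule.toSubalgebra (⨆ m : ℕ, ybComponent k r (m * d))
    (Submodule.mem_iSup_of_mem 0 (Submodule.subset_span ⟨[], by simp, rfl⟩))
    (fun x y hx hy => by
      have h : (⨆ m : ℕ, ybComponent k r (m * d)) * (⨆ m : ℕ, ybComponent k r (m * d)) ≤
          ⨆ m : ℕ, ybComponent k r (m * d) := by
        rw [Submodule.iSup_mul]
        refine iSup_le fun p => ?_
        rw [Submodule.mul_iSup]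
        refine iSup_le fun q => ?_
        refine (ybComponent_mul_le k r _ _).trans ?_
        rw [← add_mul]
        exact le_iSup (fun m : ℕ => ybComponent k r (m * d)) (p + q)
      exact h (Submodule.mul_mem_mul hx hy))

/-! ### Normal words and normal forms with respect to the degree-lexicographic order -/

/-- The (strict) degree-lexicographic order on words. -/
def DegLexLT {X : Type*} [LinearOrder X] (u v : List X) : Prop := List.Shortlex (· < ·) u v

/-- `u` is the leading monomial `LM(f)` of `f`. -/
def IsLeadingMonomial {k X : Type*} [Field k] [LinearOrder X] (f : FreeAlg k X) (u : List X) :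
    Prop :=
  f.coeff (FreeMonoid.ofList u) ≠ 0 ∧
    ∀ v : List X, f.coeff (FreeMonoid.ofList v) ≠ 0 → v ≠ u → DegLexLT v u

/-- `w` is normal modulo the ideal `I = (ℜ₀)`: it has no subword of the form `LM(f)`, `f ∈ I`. -/
def IsNormalWord (k : Type*) {X : Type*} [Field k] [LinearOrder X] (r : X × X → X × X)
    (w : List X) : Prop :=
  ∀ f ∈ ybIdeal k r, ∀ u : List X, IsLeadingMonomial f u → ¬ u <:+: w

/-- The set `𝒩_m` of the normal words of length `m`. -/
def normalWords (k : Type*) {X : Type*} [Field k] [LinearOrder X] (r : X × X → X × X) (m : ℕ) :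
    Set (List X) :=
  {w | IsNormalWord k r w ∧ w.length = m}

theorem wordPoly_sub_mem_append {k X : Type*} [Field k] {r : X × X → X × X} {u v : List X}
    (h : wordPoly k u - wordPoly k v ∈ ybIdeal k r) (a b : List X) :
    wordPoly k (a ++ u ++ b) - wordPoly k (a ++ v ++ b) ∈ ybIdeal k r := by
  have := (ybIdeal k r).mul_mem_right _ (wordPoly k b)
    ((ybIdeal k r).mul_mem_left (wordPoly k a) _ h)
  simpa only [wordPoly_append, mul_sub, sub_mul] using this

/-- Equality of words modulo the ideal `(ℜ₀)`, as a congruence of the free monoid. -/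
def ybCon (k : Type*) {X : Type*} [Field k] (r : X × X → X × X) : Con (FreeMonoid X) where
  r u v := (ybIdeal k r).ringCon (wordPoly k u.toList) (wordPoly k v.toList)
  iseqv := ⟨fun _ => (ybIdeal k r).ringCon.refl _, fun h => (ybIdeal k r).ringCon.symm h,
    fun h h' => (ybIdeal k r).ringCon.trans h h'⟩
  mul' h h' := by
    simp only [FreeMonoid.toList_mul, wordPoly_append]
    exact (ybIdeal k r).ringCon.mul h h'

theorem ybCon_iff {k X : Type*} [Field k] {r : X × X → X × X} {u v : FreeMonoid X} :
    ybCon k r u v ↔ wordPoly k u.toList - wordPoly k v.toList ∈ ybIdeal k r :=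
  (ybIdeal k r).rel_iff _ _

theorem mapDomain_eq_zero_of_mem {k X : Type*} [Field k] {r : X × X → X × X} {f : FreeAlg k X}
    (hf : f ∈ ybIdeal k r) :
    MonoidAlgebra.mapDomainRingHom k (ybCon k r).mk' f = 0 := by
  have h : ybIdeal k r ≤
      TwoSidedIdeal.ker (MonoidAlgebra.mapDomainRingHom k (ybCon k r).mk') := by
    rw [ybIdeal, TwoSidedIdeal.span_le]
    intro g hg
    obtain ⟨x, y, y', x', h1, h2, rfl⟩ := id hg
    have hc : ybCon k r (FreeMonoid.ofList [x, y]) (FreeMonoid.ofList [y', x']) :=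
      ybCon_iff.2 (TwoSidedIdeal.subset_span hg)
    have hq := (Con.eq _).2 hc
    rw [SetLike.mem_coe, TwoSidedIdeal.mem_ker, map_sub, sub_eq_zero]
    simp only [wordPoly, MonoidAlgebra.mapDomainRingHom_apply, MonoidAlgebra.mapDomain_single]
    exact congrArg (fun c => MonoidAlgebra.single c (1 : k)) hq
  exact (TwoSidedIdeal.mem_ker _).1 (h hf)

theorem exists_lt_of_isLeadingMonomial {k X : Type*} [Field k] [LinearOrder X]
    {r : X × X → X × X} {f : FreeAlg k X} (hf : f ∈ ybIdeal k r) {u : List X}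
    (hu : IsLeadingMonomial f u) :
    ∃ v, DegLexLT v u ∧ wordPoly k v - wordPoly k u ∈ ybIdeal k r := by
  classical
  by_contra! hcon
  have h0 := mapDomain_eq_zero_of_mem hf
  have h1 : (Finsupp.mapDomain (ybCon k r).mk' f.coeff) ((ybCon k r).mk' (FreeMonoid.ofList u))
      = f.coeff (FreeMonoid.ofList u) := by
    rw [Finsupp.mapDomain, Finsupp.sum_apply, Finsupp.sum,
      Finset.sum_eq_single (FreeMonoid.ofList u)]
    · simp
    · intro v hv hvu
      rw [Finsupp.single_apply, if_neg]
      intro he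
      have hne : v.toList ≠ u := fun h => hvu (by rw [← h]; rfl)
      exact hcon v.toList (hu.2 _ (Finsupp.mem_support_iff.1 hv) hne) (ybCon_iff.1 ((Con.eq _).1 he))
    · intro h
      simpa using h
  have h2 := congrArg (fun g => g.coeff ((ybCon k r).mk' (FreeMonoid.ofList u))) h0
  apply hu.1
  rw [← h1]
  simpa using h2

theorem degLexLT_append_right {X : Type*} [LinearOrder X] {u v : List X} (h : DegLexLT u v)
    (b : List X) : DegLexLT (u ++ b) (v ++ b) := by
  rcases List.shortlex_def.1 h with h | ⟨h1, h2⟩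
  · exact List.Shortlex.of_length_lt (by simpa using h)
  · refine List.Shortlex.of_lex (by simp [h1]) ?_
    clear h
    induction h2 with
    | nil => simp at h1
    | cons _ ih => exact List.Lex.cons (ih (by simpa using h1))
    | rel h => exact List.Lex.rel h

/-- Every word equals a normal word in `A(k, X, r)`. -/
theorem exists_normalForm (k : Type*) {X : Type*} [Field k] [LinearOrder X] [Finite X]
    (r : X × X → X × X) (w : List X) :
    ∃ v, IsNormalWord k r v ∧ wordPoly k w - wordPoly k v ∈ ybIdeal k r := by
  have wf : WellFounded (DegLexLT (X := X)) := List.Shortlex.wf wellFounded_lt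
  obtain ⟨m, hm, hmin⟩ := wf.has_min {v | wordPoly k w - wordPoly k v ∈ ybIdeal k r}
    ⟨w, by simp⟩
  refine ⟨m, ?_, hm⟩
  rintro f hf u hu ⟨a, b, rfl⟩
  obtain ⟨v, hvu, hv⟩ := exists_lt_of_isLeadingMonomial hf hu
  refine hmin (a ++ v ++ b) ?_ ?_
  · have h := (ybIdeal k r).sub_mem hm (wordPoly_sub_mem_append hv a b)
    simpa using h
  · rw [List.append_assoc, List.append_assoc]
    exact List.Shortlex.append_left (degLexLT_append_right hvu b) a

/-- The normal form `Nor(w)` of a word `w`: the (unique) normal word that is equal to `w` in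
`A(k, X, r)`. -/
noncomputable def nor (k : Type*) {X : Type*} [Field k] [LinearOrder X] [Finite X]
    (r : X × X → X × X) (w : List X) : List X :=
  (exists_normalForm k r w).choose

theorem nor_spec (k : Type*) {X : Type*} [Field k] [LinearOrder X] [Finite X]
    (r : X × X → X × X) (w : List X) :
    IsNormalWord k r (nor k r w) ∧ wordPoly k w - wordPoly k (nor k r w) ∈ ybIdeal k r :=
  (exists_normalForm k r w).choose_spec

theorem nor_unique {k X : Type*} [Field k] [LinearOrder X] [Finite X]
    {r : X × X → X × X} {w v : List X} (hv : IsNormalWord k r v)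
    (h : wordPoly k w - wordPoly k v ∈ ybIdeal k r) : v = nor k r w := by
  obtain ⟨hn, hw⟩ := nor_spec k r w
  have key : ∀ a b : List X, IsNormalWord k r a → DegLexLT b a →
      wordPoly k a - wordPoly k b ∈ ybIdeal k r → False := by
    intro a b ha hba hI
    have hne : FreeMonoid.ofList b ≠ FreeMonoid.ofList a := by
      intro he
      have : b = a := he
      subst this
      exact Std.Asymm.asymm (r := List.Shortlex (α := X) (· < ·)) _ _ hba hba
    refine ha _ hI a ⟨?_, fun c hc hca => ?_⟩ (List.infix_refl a)
    · simp [wordPoly, hne]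
    · have hca' : FreeMonoid.ofList a ≠ FreeMonoid.ofList c := fun he => hca he.symm
      by_cases hcb : c = b
      · exact hcb ▸ hba
      · have hcb' : FreeMonoid.ofList b ≠ FreeMonoid.ofList c := fun he => hcb he.symm
        exact absurd (by simp [wordPoly, hca', hcb']) hc
  have h1 : wordPoly k (nor k r w) - wordPoly k v ∈ ybIdeal k r := by
    have := (ybIdeal k r).sub_mem h hw
    simpa using this
  have h2 : wordPoly k v - wordPoly k (nor k r w) ∈ ybIdeal k r := by
    have := (ybIdeal k r).neg_mem h1
    simpa using this
  by_contra hne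
  rcases List.Shortlex.trichotomous (α := X) (r := (· < ·)) |>.rel_or_eq_or_rel_swap
    (a := v) (b := nor k r w) with h3 | h3 | h3
  · exact key _ _ hn h3 h1
  · exact hne h3
  · exact key _ _ hv h3 h2

/-! ### The normalized `d`-Veronese solution -/

/-- The left action `ᶜ(b₁b₂⋯b_q) = (ᶜb₁)(ᶜ'b₂⋯b_q)` of a letter on a word, where `c' = c^{b₁}`. -/
def leftLetter {X : Type*} (r : X × X → X × X) : X → List X → List X
  | _, [] => []
  | c, b :: bs => (r (c, b)).1 :: leftLetter r (r (c, b)).2 bs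

/-- The left action `ᵃb` of words on words: the letters of `a` act successively,
the last one first. -/
def leftWord {X : Type*} (r : X × X → X × X) (a b : List X) : List X :=
  a.foldr (leftLetter r) b

/-- The right action `(a₁a₂⋯a_p)ᶜ = (a₁^{c'})((a₂⋯a_p)ᶜ)` of a letter on a word, where
`c'` is the letter obtained from `c` by the left action of the word `a₂⋯a_p`. -/
def rightLetter {X : Type*} (r : X × X → X × X) : List X → X → List X
  | [], _ => []
  | a :: as, c => (r (a, as.foldr (fun x y => (r (x, y)).1) c)).2 :: rightLetter r as c

/-- The right action `aᵇ` of words on words: the letters of `b` act successively,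
the first one first. -/
def rightWord {X : Type*} (r : X × X → X × X) (a b : List X) : List X :=
  b.foldl (rightLetter r) a

/-- The map `ρ (a, b) = (Nor(ᵃb), Nor(aᵇ))`; its restriction to `𝒩_d × 𝒩_d` is `ρ_d`. -/
noncomputable def rho (k : Type*) {X : Type*} [Field k] [LinearOrder X] [Finite X]
    (r : X × X → X × X) (p : List X × List X) : List X × List X :=
  (nor k r (leftWord r p.1 p.2), nor k r (rightWord r p.1 p.2))

/-! ### The `d`-Veronese solution `(Y, r_Y)`, where `Y = {y₁, …, y_N}` is indexed by `Fin N` -/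

/-- `w` is the enumeration `w₁ < w₂ < ⋯ < w_N` of the set `𝒩_d` in its lexicographic order. -/
def IsNormalEnumeration (k : Type*) {X : Type*} [Field k] [LinearOrder X]
    (r : X × X → X × X) (d : ℕ) {N : ℕ} (w : Fin N → List X) : Prop :=
  Set.range w = normalWords k r d ∧ ∀ i j, i < j → List.Lex (· < ·) (w i) (w j)

/-- `rY` is the map `r_Y` of the `d`-Veronese solution:
`r_Y (y_j, y_i) = (y_{i'}, y_{j'})` iff `ρ (w_j, w_i) = (w_{i'}, w_{j'})`. -/
def IsVeroneseSolution (k : Type*) {X : Type*} [Field k] [LinearOrder X] [Finite X]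
    (r : X × X → X × X) {N : ℕ} (w : Fin N → List X)
    (rY : Fin N × Fin N → Fin N × Fin N) : Prop :=
  ∀ j i i' j', rY (j, i) = (i', j') ↔ rho k r (w j, w i) = (w i', w j')

/-- The set `P(n,d)` of the pairs `(i, j)` with `· ρ(w_i, w_j) ≥ w_i w_j`. -/
def setP (k : Type*) {X : Type*} [Field k] [LinearOrder X] [Finite X]
    (r : X × X → X × X) {N : ℕ} (w : Fin N → List X) : Set (Fin N × Fin N) :=
  {p | ¬ DegLexLT ((rho k r (w p.1, w p.2)).1 ++ (rho k r (w p.1, w p.2)).2) (w p.1 ++ w p.2)}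

/-- The set `C(n,d)` of the pairs `(i, j) ∈ P(n,d)` such that `w_i w_j` is normal. -/
def setC (k : Type*) {X : Type*} [Field k] [LinearOrder X] [Finite X]
    (r : X × X → X × X) {N : ℕ} (w : Fin N → List X) : Set (Fin N × Fin N) :=
  {p | p ∈ setP k r w ∧ IsNormalWord k r (w p.1 ++ w p.2)}

/-- The set `MV(n,d)` of the pairs `(i, j) ∈ P(n,d)` such that `w_i w_j` is not normal. -/
def setMV (k : Type*) {X : Type*} [Field k] [LinearOrder X] [Finite X]
    (r : X × X → X × X) {N : ℕ} (w : Fin N → List X) : Set (Fin N × Fin N) :=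
  {p | p ∈ setP k r w ∧ ¬ IsNormalWord k r (w p.1 ++ w p.2)}

/-- `w_{i₀} w_{j₀} = Nor(w_i w_j)` with `(i, j) = p ∈ MV(n,d)` and `(i₀, j₀) = q ∈ C(n,d)`. -/
def IsReduction (k : Type*) {X : Type*} [Field k] [LinearOrder X] [Finite X]
    (r : X × X → X × X) {N : ℕ} (w : Fin N → List X) (p q : Fin N × Fin N) : Prop :=
  p ∈ setMV k r w ∧ q ∈ setC k r w ∧ w q.1 ++ w q.2 = nor k r (w p.1 ++ w p.2)

/-- The set of the elements `γ_{ij} = y_i y_j - y_{i₀} y_{j₀}` of `A_Y`, where `(i, j) ∈ MV(n,d)`,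
`(i₀, j₀) ∈ C(n,d)` and `w_{i₀} w_{j₀} = Nor(w_i w_j)`. -/
def kernelRelations (k : Type*) {X : Type*} [Field k] [LinearOrder X] [Finite X]
    (r : X × X → X × X) {N : ℕ} (w : Fin N → List X) (rY : Fin N × Fin N → Fin N × Fin N) :
    Set (YBAlgebra k rY) :=
  {z | ∃ p q : Fin N × Fin N, IsReduction k r w p q ∧
    z = ybWord k rY [p.1, p.2] - ybWord k rY [q.1, q.2]}

/-! ### Words of a solution and their commutative shadow -/

/-! The argument linearizes words by their shadows. Writing `x₁x₂x₃⋯` as the list `x₁, ˣ¹x₂, ˣ¹ˣ²x₃,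
…`, a relation `xy = y'x'` just exchanges two neighbouring letters of the list: involutivity gives
the exchange, and the braid relation leaves all later letters unchanged. Left nondegeneracy makes
every list the shadow of exactly one word. Hence two words are equal modulo the relations iff their
shadows are the same multiset (`wordEq_iff`). This gives left cancellation, the number of normal
words of each length, and the descent of the actions of words on words to classes. The Veronese map
`r_Y` is this action on the classes of length `d`, and `IsBlockSolution.isSolution` shows that it is
again a solution.

For the kernel, cut words of length `md` into `m` blocks of length `d`. A single relation in `X`
touches at most two consecutive blocks. So a homomorphism on `A_Y` that identifies the quadratic
words with equal images in `A_X` identifies all words with equal images, and therefore kills the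
kernel (`map_eq_zero`). The quotient by the `γ_{ij}` is such a homomorphism: the set `P` meets every
orbit of `r_Y` exactly once, and modulo the `γ_{ij}` each of its pairs becomes the pair of `C` that
spells the normal form.

The same transversality gives independence, minimality and the count. Distinct pairs of `P` are
distinct quadratic monomials of `A_Y`, and no pair of `MV` lies in `C`, so the coefficient at `y_i
y_j` detects `γ_{ij}` and vanishes on the ideal generated by the others. Finally `|P|` counts
unordered pairs and `|C| = |𝒩_{2d}|`. -/

section Words

variable {X : Type*}

/-- The letter map `y ↦ ᵘy` given by the left action of the word `u`. -/
def actWord (r : X × X → X × X) (u : List X) (y : X) : X :=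
  u.foldr (fun x z => (r (x, z)).1) y

@[simp] theorem actWord_nil (r : X × X → X × X) : actWord r [] = id := rfl

theorem actWord_cons (r : X × X → X × X) (x : X) (u : List X) (y : X) :
    actWord r (x :: u) y = (r (x, actWord r u y)).1 := rfl

theorem actWord_append (r : X × X → X × X) (u v : List X) (y : X) :
    actWord r (u ++ v) y = actWord r u (actWord r v y) := by
  simp [actWord]

/-- The word `x₁ · ˣ¹x₂ · ˣ¹ˣ²x₃ ⋯` attached to `x₁x₂x₃⋯`; it turns the relations of the
Yang–Baxter algebra into transpositions of letters. -/
def shadow (r : X × X → X × X) : List X → List X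
  | [] => []
  | x :: u => x :: (shadow r u).map fun y => (r (x, y)).1

@[simp] theorem shadow_nil (r : X × X → X × X) : shadow r [] = [] := rfl

theorem shadow_cons (r : X × X → X × X) (x : X) (u : List X) :
    shadow r (x :: u) = x :: (shadow r u).map fun y => (r (x, y)).1 := rfl

@[simp] theorem length_shadow (r : X × X → X × X) (u : List X) :
    (shadow r u).length = u.length := by
  induction u with
  | nil => rfl
  | cons x u ih => simp [shadow_cons, ih]

theorem shadow_append (r : X × X → X × X) (u v : List X) :
    shadow r (u ++ v) = shadow r u ++ (shadow r v).map (actWord r u) := by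
  induction u with
  | nil => simp
  | cons x u ih =>
    simp only [List.cons_append, shadow_cons, ih, List.map_append, List.map_map]
    rfl

/-- One application of a relation `xy = y'x'` inside a word. -/
inductive WordStep (r : X × X → X × X) : List X → List X → Prop
  | mk (a : List X) (x y : X) (b : List X) :
      WordStep r (a ++ x :: y :: b) (a ++ (r (x, y)).1 :: (r (x, y)).2 :: b)

/-- Two words are equal modulo the relations `xy = y'x'`. -/
def WordEq (r : X × X → X × X) : List X → List X → Prop := Relation.EqvGen (WordStep r)

theorem WordEq.refl (r : X × X → X × X) (u : List X) : WordEq r u u := Relation.EqvGen.refl u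

theorem WordEq.symm {r : X × X → X × X} {u v : List X} (h : WordEq r u v) : WordEq r v u :=
  Relation.EqvGen.symm _ _ h

theorem WordEq.trans {r : X × X → X × X} {u v w : List X} (h : WordEq r u v)
    (h' : WordEq r v w) : WordEq r u w :=
  Relation.EqvGen.trans _ _ _ h h'

theorem WordEq.append_left {r : X × X → X × X} {u v : List X} (h : WordEq r u v) (c : List X) :
    WordEq r (c ++ u) (c ++ v) := by
  induction h with
  | rel _ _ h =>
    obtain ⟨a, x, y, b⟩ := h
    rw [← List.append_assoc, ← List.append_assoc]
    exact Relation.EqvGen.rel _ _ (WordStep.mk (c ++ a) x y b)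
  | refl => exact WordEq.refl _ _
  | symm _ _ _ ih => exact ih.symm
  | trans _ _ _ _ _ ih ih' => exact ih.trans ih'

theorem WordEq.cons {r : X × X → X × X} {u v : List X} (h : WordEq r u v) (x : X) :
    WordEq r (x :: u) (x :: v) :=
  h.append_left [x]

theorem WordEq.append_right {r : X × X → X × X} {u v : List X} (h : WordEq r u v) (c : List X) :
    WordEq r (u ++ c) (v ++ c) := by
  induction h with
  | rel _ _ h =>
    obtain ⟨a, x, y, b⟩ := h
    simp only [List.append_assoc, List.cons_append]
    exact Relation.EqvGen.rel _ _ (WordStep.mk a x y (b ++ c))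
  | refl => exact WordEq.refl _ _
  | symm _ _ _ ih => exact ih.symm
  | trans _ _ _ _ _ ih ih' => exact ih.trans ih'

theorem WordEq.swap (r : X × X → X × X) (x y : X) (b : List X) :
    WordEq r (x :: y :: b) ((r (x, y)).1 :: (r (x, y)).2 :: b) :=
  Relation.EqvGen.rel _ _ (WordStep.mk [] x y b)

variable {r : X × X → X × X}

namespace IsSolution

/-- This is the first coordinate of the braid relation: `xy` and `y'x'` act on letters in the same
way. -/
theorem left_comp (hr : IsSolution r) (x y z : X) :
    (r ((r (x, y)).1, (r ((r (x, y)).2, z)).1)).1 = (r (x, (r (y, z)).1)).1 :=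
  congrArg (fun t : X × X × X => t.1) (congrFun hr.braid (x, y, z))

theorem left_swap (hr : IsSolution r) (x y : X) : (r ((r (x, y)).1, (r (x, y)).2)).1 = x :=
  congrArg Prod.fst (hr.involutive (x, y))

theorem actWord_injective (hr : IsSolution r) (u : List X) :
    Function.Injective (actWord r u) := by
  induction u with
  | nil => exact Function.injective_id
  | cons x u ih => exact (hr.left_nondegenerate x).1.comp ih

/-- The two-letter shadows are `x, ˣy` and `ˣy, x`. The letters after them are acted on by `xy` in
one case and by `y'x'` in the other, hence agree by `left_comp`. -/
theorem shadow_step (hr : IsSolution r) {u v : List X} (h : WordStep r u v) :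
    (shadow r u).Perm (shadow r v) := by
  obtain ⟨a, x, y, b⟩ := h
  rw [shadow_append, shadow_append]
  refine List.Perm.append_left _ (List.Perm.map _ ?_)
  simp only [shadow_cons, List.map_cons, List.map_map, hr.left_swap]
  have h : ((fun z => (r (x, z)).1) ∘ fun z => (r (y, z)).1) =
      (fun z => (r ((r (x, y)).1, z)).1) ∘ fun z => (r ((r (x, y)).2, z)).1 := by
    funext z
    exact (hr.left_comp x y z).symm
  rw [h]
  exact List.Perm.swap _ _ _

theorem actWord_step (hr : IsSolution r) {u v : List X} (h : WordStep r u v) :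
    actWord r u = actWord r v := by
  obtain ⟨a, x, y, b⟩ := h
  funext z
  simp only [actWord_append, actWord_cons, hr.left_comp]

theorem shadow_perm (hr : IsSolution r) {u v : List X} (h : WordEq r u v) :
    (shadow r u).Perm (shadow r v) := by
  induction h with
  | rel _ _ h => exact hr.shadow_step h
  | refl => exact List.Perm.refl _
  | symm _ _ _ ih => exact ih.symm
  | trans _ _ _ _ _ ih ih' => exact ih.trans ih'

theorem actWord_eq (hr : IsSolution r) {u v : List X} (h : WordEq r u v) :
    actWord r u = actWord r v := by
  induction h with
  | rel _ _ h => exact hr.actWord_step h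
  | refl => rfl
  | symm _ _ _ ih => exact ih.symm
  | trans _ _ _ _ _ ih ih' => exact ih.trans ih'

/-- The left action of a letter, as a permutation of `X`. -/
noncomputable def leftPerm (hr : IsSolution r) (x : X) : Equiv.Perm X :=
  Equiv.ofBijective _ (hr.left_nondegenerate x)

theorem leftPerm_apply (hr : IsSolution r) (x y : X) : hr.leftPerm x y = (r (x, y)).1 := rfl

/-- The word whose shadow is the image of a given word under a permutation of the letters. -/
noncomputable def unshadow (hr : IsSolution r) : Equiv.Perm X → List X → List X
  | _, [] => []
  | σ, x :: l => σ x :: unshadow hr ((hr.leftPerm (σ x))⁻¹ * σ) l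

theorem shadow_unshadow (hr : IsSolution r) (σ : Equiv.Perm X) (l : List X) :
    shadow r (hr.unshadow σ l) = l.map σ := by
  induction l generalizing σ with
  | nil => rfl
  | cons x l ih =>
    simp only [unshadow, shadow_cons, ih, List.map_map, List.map_cons]
    congr 1
    refine List.map_congr_left fun y _ => ?_
    exact (hr.leftPerm (σ x)).apply_symm_apply (σ y)

theorem unshadow_map (hr : IsSolution r) (σ τ : Equiv.Perm X) (l : List X) :
    hr.unshadow σ (l.map τ) = hr.unshadow (σ * τ) l := by
  induction l generalizing σ with
  | nil => rfl
  | cons x l ih => simp only [List.map_cons, unshadow, ih, mul_assoc, Equiv.Perm.mul_apply]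

theorem unshadow_shadow (hr : IsSolution r) (u : List X) :
    hr.unshadow 1 (shadow r u) = u := by
  induction u with
  | nil => rfl
  | cons x u ih =>
    have h : (fun y => (r (x, y)).1) = ⇑(hr.leftPerm x) := rfl
    rw [shadow_cons, unshadow, h, unshadow_map]
    simp [ih]

/-- An adjacent transposition of the shadow is realized by one relation of the word, and adjacent
transpositions generate all permutations. -/
theorem unshadow_perm (hr : IsSolution r) {l l' : List X} (h : l.Perm l') :
    ∀ σ : Equiv.Perm X, WordEq r (hr.unshadow σ l) (hr.unshadow σ l') := by
  induction h with
  | nil => exact fun _ => WordEq.refl _ _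
  | cons x _ ih => exact fun σ => (ih _).cons _
  | swap x y l =>
    intro σ
    simp only [unshadow]
    set a := σ x
    set b := σ y
    set c := (((hr.leftPerm b)⁻¹ * σ : Equiv.Perm X)) x with hc
    have hbc : (r (b, c)).1 = a := (hr.leftPerm b).apply_symm_apply a
    have hc' : (r (b, c)).2 = (((hr.leftPerm a)⁻¹ * σ : Equiv.Perm X)) y := by
      apply (hr.leftPerm a).injective
      have h1 : hr.leftPerm a ((((hr.leftPerm a)⁻¹ * σ : Equiv.Perm X)) y) = b :=
        (hr.leftPerm a).apply_symm_apply b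
      rw [h1, leftPerm_apply, ← hbc]
      exact hr.left_swap b c
    have h := WordEq.swap r b c (hr.unshadow ((hr.leftPerm c)⁻¹ * ((hr.leftPerm b)⁻¹ * σ)) l)
    -- The tails are unshadowed with the same permutation, because `bc` and its image under `r` act
    -- alike.
    have hp : (hr.leftPerm c)⁻¹ * ((hr.leftPerm b)⁻¹ * σ) =
        (hr.leftPerm (r (b, c)).2)⁻¹ * ((hr.leftPerm (r (b, c)).1)⁻¹ * σ) := by
      rw [← mul_assoc, ← mul_assoc, ← mul_inv_rev, ← mul_inv_rev]
      congr 2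
      ext z
      exact (hr.left_comp b c z).symm
    rw [hp, hbc, hc'] at h
    rw [hp, hbc, hc']
    exact h
  | trans _ _ ih ih' => exact fun σ => (ih σ).trans (ih' σ)

/-- Two words are equal modulo the relations iff their shadows agree up to the order of the
letters. -/
theorem wordEq_iff (hr : IsSolution r) {u v : List X} :
    WordEq r u v ↔ (shadow r u).Perm (shadow r v) := by
  refine ⟨hr.shadow_perm, fun h => ?_⟩
  simpa only [unshadow_shadow] using hr.unshadow_perm h 1

theorem length_eq (hr : IsSolution r) {u v : List X} (h : WordEq r u v) :
    u.length = v.length := by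
  simpa using (hr.shadow_perm h).length_eq

/-- Left cancellation: the shadow of `c` is a common prefix, and the rest is moved by the injective
map `actWord r c`. -/
theorem wordEq_append_left_iff (hr : IsSolution r) {c u v : List X} :
    WordEq r (c ++ u) (c ++ v) ↔ WordEq r u v := by
  rw [hr.wordEq_iff, hr.wordEq_iff, shadow_append, shadow_append, List.perm_append_left_iff,
    List.map_perm_map_iff (hr.actWord_injective c)]

end IsSolution

theorem WordEq.append {u v u' v' : List X} (h : WordEq r u v) (h' : WordEq r u' v') :
    WordEq r (u ++ u') (v ++ v') :=
  (h.append_right u').trans (h'.append_left v)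

/-! ### The braided monoid structure on words -/

@[simp] theorem length_leftLetter (r : X × X → X × X) (c : X) (b : List X) :
    (leftLetter r c b).length = b.length := by
  induction b generalizing c with
  | nil => rfl
  | cons x b ih => simp [leftLetter, ih]

@[simp] theorem length_leftWord (r : X × X → X × X) (a b : List X) :
    (leftWord r a b).length = b.length := by
  induction a with
  | nil => rfl
  | cons x a ih => exact (length_leftLetter r x _).trans ih

@[simp] theorem length_rightLetter (r : X × X → X × X) (a : List X) (c : X) :
    (rightLetter r a c).length = a.length := by
  induction a with
  | nil => rfl
  | cons x a ih => simp [rightLetter, ih]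

@[simp] theorem length_rightWord (r : X × X → X × X) (a b : List X) :
    (rightWord r a b).length = a.length := by
  induction b generalizing a with
  | nil => rfl
  | cons x b ih => exact (ih _).trans (length_rightLetter r a x)

theorem leftWord_cons (r : X × X → X × X) (a : List X) (c : X) (b : List X) :
    leftWord r a (c :: b) = actWord r a c :: leftWord r (rightLetter r a c) b := by
  induction a with
  | nil => rfl
  | cons x a ih =>
    change leftLetter r x (leftWord r a (c :: b)) = _
    rw [ih]
    rfl

theorem rightWord_cons (r : X × X → X × X) (a : List X) (c : X) (b : List X) :
    rightWord r a (c :: b) = rightWord r (rightLetter r a c) b := rfl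

theorem wordEq_rightLetter (r : X × X → X × X) (a : List X) (c : X) :
    WordEq r (a ++ [c]) (actWord r a c :: rightLetter r a c) := by
  induction a with
  | nil => exact WordEq.refl _ _
  | cons x a ih => exact (ih.cons x).trans (WordEq.swap r x _ _)

/-- The identity `ab = (ᵃb)(aᵇ)`. -/
theorem wordEq_leftWord_rightWord (r : X × X → X × X) (a b : List X) :
    WordEq r (a ++ b) (leftWord r a b ++ rightWord r a b) := by
  induction b generalizing a with
  | nil =>
    have h : leftWord r a [] = [] := List.length_eq_zero_iff.1 (length_leftWord r a [])
    rw [h, List.append_nil]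
    exact WordEq.refl _ _
  | cons c b ih =>
    rw [leftWord_cons, rightWord_cons]
    have h := (wordEq_rightLetter r a c).append_right b
    rw [List.append_assoc] at h
    exact h.trans ((ih _).cons _)

namespace IsSolution

theorem shadow_leftLetter (hr : IsSolution r) (c : X) (b : List X) :
    shadow r (leftLetter r c b) = (shadow r b).map fun y => (r (c, y)).1 := by
  induction b generalizing c with
  | nil => rfl
  | cons x b ih =>
    simp only [leftLetter, shadow_cons, ih, List.map_map, List.map_cons]
    congr 1
    exact List.map_congr_left fun z _ => hr.left_comp c x z

/-- On shadows the left action of a word is letter by letter, so compatibility with the relations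
and injectivity can be read off from multisets. -/
theorem shadow_leftWord (hr : IsSolution r) (a b : List X) :
    shadow r (leftWord r a b) = (shadow r b).map (actWord r a) := by
  induction a with
  | nil => simp [leftWord]
  | cons x a ih =>
    change shadow r (leftLetter r x (leftWord r a b)) = _
    rw [hr.shadow_leftLetter, ih, List.map_map]
    rfl

theorem leftWord_congr (hr : IsSolution r) {a a' b b' : List X} (ha : WordEq r a a')
    (hb : WordEq r b b') : WordEq r (leftWord r a b) (leftWord r a' b') := by
  rw [hr.wordEq_iff, hr.shadow_leftWord, hr.shadow_leftWord, hr.actWord_eq ha]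
  exact (hr.shadow_perm hb).map _

theorem wordEq_of_leftWord (hr : IsSolution r) {a b b' : List X}
    (h : WordEq r (leftWord r a b) (leftWord r a b')) : WordEq r b b' := by
  rwa [hr.wordEq_iff, hr.shadow_leftWord, hr.shadow_leftWord,
    List.map_perm_map_iff (hr.actWord_injective a), ← hr.wordEq_iff] at h

/-- If `ab = a'b'` with `a' = ᵃb`, then `ᵃ'b' = a`. -/
theorem leftWord_of_wordEq (hr : IsSolution r) {a b a' b' : List X}
    (h : WordEq r (a ++ b) (a' ++ b')) (h' : WordEq r a' (leftWord r a b)) :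
    WordEq r (leftWord r a' b') a := by
  rw [hr.wordEq_iff] at h h' ⊢
  rw [hr.shadow_leftWord] at h' ⊢
  rw [shadow_append, shadow_append] at h
  -- Up to order, the shadow of `ab` is that of `a` together with that of `ᵃb`, and the latter is
  -- that of `a'`; cancelling it from the shadow of `a'b'` leaves that of `a`.
  have h1 := (h.symm.trans List.perm_append_comm).trans (h'.symm.append_right _)
  exact (List.perm_append_left_iff _).1 h1

/-- By left cancellation, `aᵇ` is determined up to the relations by `ab = (ᵃb)(aᵇ)`. -/
theorem rightWord_congr (hr : IsSolution r) {a a' b b' : List X} (ha : WordEq r a a')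
    (hb : WordEq r b b') : WordEq r (rightWord r a b) (rightWord r a' b') := by
  have h := ((wordEq_leftWord_rightWord r a b).symm.trans (ha.append hb)).trans
    (wordEq_leftWord_rightWord r a' b')
  have h' := (hr.leftWord_congr ha hb).symm.append_right (rightWord r a' b')
  exact hr.wordEq_append_left_iff.1 (h.trans h')

/-- The letters of `a` are found from the last to the first: once the tail is known, so is the
letter acting on the next one, and right nondegeneracy solves for it. -/
theorem exists_rightLetter (hr : IsSolution r) (t : List X) (c : X) :
    ∃ a, rightLetter r a c = t := by
  induction t with
  | nil => exact ⟨[], rfl⟩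
  | cons x t ih =>
    obtain ⟨a, rfl⟩ := ih
    obtain ⟨y, hy⟩ := (hr.right_nondegenerate (actWord r a c)).2 x
    exact ⟨y :: a, congrArg (· :: rightLetter r a c) hy⟩

theorem exists_rightWord (hr : IsSolution r) (t b : List X) : ∃ a, rightWord r a b = t := by
  induction b with
  | nil => exact ⟨t, rfl⟩
  | cons c b ih =>
    obtain ⟨a, rfl⟩ := ih
    obtain ⟨a', rfl⟩ := hr.exists_rightLetter a c
    exact ⟨a', rfl⟩

end IsSolution

end Words

/-! ### The Yang–Baxter algebra as a monoid algebra -/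

section Algebra

variable {k X : Type*} [Field k] {r : X × X → X × X}

/-- Equality of words modulo the relations, as a congruence of the free monoid. -/
def wordCon (r : X × X → X × X) : Con (FreeMonoid X) where
  r u v := WordEq r u.toList v.toList
  iseqv := ⟨fun _ => WordEq.refl _ _, WordEq.symm, WordEq.trans⟩
  mul' h h' := h.append h'

/-- The class of a word in the monoid of the solution. -/
def wordClass (r : X × X → X × X) (u : List X) : (wordCon r).Quotient :=
  (wordCon r).mk' (FreeMonoid.ofList u)

theorem wordClass_eq_iff {u v : List X} : wordClass r u = wordClass r v ↔ WordEq r u v :=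
  Con.eq _

theorem wordClass_append (u v : List X) :
    wordClass r (u ++ v) = wordClass r u * wordClass r v := by
  simp [wordClass, FreeMonoid.ofList_append]

theorem mk_eq_zero_iff {f : FreeAlg k X} :
    ((ybIdeal k r).ringCon.mk' f : YBAlgebra k r) = 0 ↔ f ∈ ybIdeal k r := by
  rw [← map_zero (ybIdeal k r).ringCon.mk', TwoSidedIdeal.mem_iff]
  exact RingCon.eq _

theorem ybWord_eq_iff_mem {u v : List X} :
    ybWord k r u = ybWord k r v ↔ wordPoly k u - wordPoly k v ∈ ybIdeal k r := by
  rw [← sub_eq_zero, ybWord, ybWord, ← map_sub, mk_eq_zero_iff]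

theorem ybIdeal_le_ker {B F : Type*} [Ring B] [FunLike F (FreeAlg k X) B]
    [RingHomClass F (FreeAlg k X) B] (f : F)
    (h : ∀ x y, f (wordPoly k [x, y]) = f (wordPoly k [(r (x, y)).1, (r (x, y)).2])) :
    ybIdeal k r ≤ TwoSidedIdeal.ker f := by
  rw [ybIdeal, TwoSidedIdeal.span_le]
  rintro _ ⟨x, y, y', x', h1, _, rfl⟩
  rw [SetLike.mem_coe, TwoSidedIdeal.mem_ker, map_sub, sub_eq_zero, h, h1]

/-- An algebra homomorphism defined on `A(k, X, r)` by its values on the letters. -/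
noncomputable def ybLift (k : Type*) {X : Type*} [Field k] (r : X × X → X × X) {B : Type*} [Ring B]
    [Algebra k B] (g : X → B)
    (h : ∀ x y, g x * g y = g (r (x, y)).1 * g (r (x, y)).2) : YBAlgebra k r →ₐ[k] B :=
  RingCon.liftₐ (ybIdeal k r).ringCon (MonoidAlgebra.lift k B (FreeMonoid X) (FreeMonoid.lift g))
    (by
      have hle : ybIdeal k r ≤
          TwoSidedIdeal.ker (MonoidAlgebra.lift k B (FreeMonoid X) (FreeMonoid.lift g)) := by
        refine ybIdeal_le_ker _ fun x y => ?_
        simpa [wordPoly, FreeMonoid.lift_apply] using h x y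
      intro a b hab
      have := hle ((TwoSidedIdeal.rel_iff _ _ _).1 hab)
      rw [TwoSidedIdeal.mem_ker, map_sub, sub_eq_zero] at this
      exact this)

theorem ybLift_ybWord {B : Type*} [Ring B] [Algebra k B] (g : X → B)
    (h : ∀ x y, g x * g y = g (r (x, y)).1 * g (r (x, y)).2) (u : List X) :
    ybLift k r g h (ybWord k r u) = (u.map g).prod := by
  change MonoidAlgebra.lift k B (FreeMonoid X) (FreeMonoid.lift g) (wordPoly k u) = _
  simp [wordPoly, FreeMonoid.lift_apply]

theorem ybWord_cons (x : X) (u : List X) :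
    ybWord k r (x :: u) = ybWord k r [x] * ybWord k r u :=
  ybWord_append k r [x] u

theorem ybWord_swap (x y : X) :
    ybWord k r [x, y] = ybWord k r [(r (x, y)).1, (r (x, y)).2] := by
  rw [ybWord_eq_iff_mem]
  by_cases h : (x, y) = r (x, y)
  · have h1 := congrArg Prod.fst h
    have h2 := congrArg Prod.snd h
    simp only at h1 h2
    rw [← h1, ← h2, sub_self]
    exact (ybIdeal k r).zero_mem
  · exact TwoSidedIdeal.subset_span ⟨x, y, _, _, rfl, h, rfl⟩

variable (k) in
theorem WordEq.ybWord_eq {u v : List X} (h : WordEq r u v) : ybWord k r u = ybWord k r v := by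
  induction h with
  | rel _ _ h =>
    obtain ⟨a, x, y, b⟩ := h
    have e : ∀ x y : X, a ++ x :: y :: b = a ++ ([x, y] ++ b) := fun _ _ => rfl
    rw [e, e]
    simp only [ybWord_append k r a, ybWord_append k r [_, _] b]
    rw [ybWord_swap]
  | refl => rfl
  | symm _ _ _ ih => exact ih.symm
  | trans _ _ _ _ _ ih ih' => exact ih.trans ih'

/-- The homomorphism from `A(k, X, r)` to the monoid algebra of the monoid of the solution. -/
noncomputable def ybToMonoid (k : Type*) {X : Type*} [Field k] (r : X × X → X × X) :
    YBAlgebra k r →ₐ[k] MonoidAlgebra k (wordCon r).Quotient :=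
  ybLift k r (fun x => MonoidAlgebra.of k _ (wordClass r [x])) fun x y => by
    rw [← map_mul, ← map_mul, ← wordClass_append, ← wordClass_append]
    exact congrArg _ (wordClass_eq_iff.2 (WordEq.swap r x y []))

theorem ybToMonoid_ybWord (u : List X) :
    ybToMonoid k r (ybWord k r u) = MonoidAlgebra.single (wordClass r u) 1 := by
  rw [ybToMonoid, ybLift_ybWord]
  induction u with
  | nil => rfl
  | cons x u ih =>
    rw [List.map_cons, List.prod_cons, ih, MonoidAlgebra.of_apply, MonoidAlgebra.single_mul_single,
      ← wordClass_append, one_mul]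
    rfl

/-- Linear combinations of relations identify no further words: distinct classes are distinct basis
elements of the monoid algebra. -/
theorem ybWord_eq_iff {u v : List X} : ybWord k r u = ybWord k r v ↔ WordEq r u v := by
  refine ⟨fun h => ?_, WordEq.ybWord_eq k⟩
  have h1 := congrArg (ybToMonoid k r) h
  rw [ybToMonoid_ybWord, ybToMonoid_ybWord] at h1
  exact wordClass_eq_iff.1 (MonoidAlgebra.single_left_injective (one_ne_zero) h1)

theorem wordPoly_sub_mem_iff {u v : List X} :
    wordPoly k u - wordPoly k v ∈ ybIdeal k r ↔ WordEq r u v := by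
  rw [← ybWord_eq_iff_mem, ybWord_eq_iff]

theorem ybWord_induction {P : YBAlgebra k r → Prop} (h0 : P 0)
    (hw : ∀ u, P (ybWord k r u)) (hadd : ∀ a b, P a → P b → P (a + b))
    (hs : ∀ (c : k) a, P a → P (c • a)) (a : YBAlgebra k r) : P a := by
  obtain ⟨f, rfl⟩ := RingCon.mk'_surjective (ybIdeal k r).ringCon a
  induction f using MonoidAlgebra.induction_linear with
  | zero => rw [map_zero]; exact h0
  | add f g hf hg => rw [map_add]; exact hadd _ _ hf hg
  | single u c =>
    have : MonoidAlgebra.single u c = c • wordPoly k u.toList := by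
      simp [wordPoly]
    rw [this]
    exact hs c _ (hw _)

end Algebra

/-! ### Normal words -/

section Normal

variable {k X : Type*} [Field k] [LinearOrder X] {r : X × X → X × X}

theorem IsNormalWord.infix {u v : List X} (hv : IsNormalWord k r v) (h : u <:+: v) :
    IsNormalWord k r u :=
  fun f hf a ha hau => hv f hf a ha (hau.trans h)

theorem degLexLT_trichotomous (u v : List X) : DegLexLT u v ∨ u = v ∨ DegLexLT v u :=
  List.Shortlex.trichotomous (α := X) (r := (· < ·)) |>.rel_or_eq_or_rel_swap

theorem degLexLT_asymm {u v : List X} (h : DegLexLT u v) : ¬ DegLexLT v u :=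
  fun h' => Std.Asymm.asymm (r := List.Shortlex (α := X) (· < ·)) _ _ h h'

theorem isLeadingMonomial_sub {u v : List X} (h : DegLexLT v u) :
    IsLeadingMonomial (wordPoly k u - wordPoly k v) u := by
  classical
  have hne : FreeMonoid.ofList v ≠ FreeMonoid.ofList u := by
    intro he
    have : v = u := he
    exact degLexLT_asymm (this ▸ h) (this ▸ h)
  refine ⟨by simp [wordPoly, hne], fun c hc hcu => ?_⟩
  have hcu' : FreeMonoid.ofList u ≠ FreeMonoid.ofList c := fun he => hcu he.symm
  by_cases hcv : c = v
  · exact hcv ▸ h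
  · have hcv' : FreeMonoid.ofList v ≠ FreeMonoid.ofList c := fun he => hcv he.symm
    exact absurd (by simp [wordPoly, hcu', hcv']) hc

/-- A normal word is the smallest one in its class. -/
theorem IsNormalWord.not_degLexLT {u v : List X} (hu : IsNormalWord k r u) (h : WordEq r u v) :
    ¬ DegLexLT v u := fun hlt =>
  hu _ (wordPoly_sub_mem_iff.2 h) u (isLeadingMonomial_sub hlt) (List.infix_refl u)

variable [Finite X]

theorem isNormalWord_nor (u : List X) : IsNormalWord k r (nor k r u) := (nor_spec k r u).1

variable (k) in
theorem wordEq_nor (u : List X) : WordEq r u (nor k r u) :=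
  wordPoly_sub_mem_iff.1 (nor_spec k r u).2

theorem nor_eq_of_wordEq {u v : List X} (h : WordEq r u v) : nor k r u = nor k r v :=
  nor_unique (isNormalWord_nor u) (wordPoly_sub_mem_iff.2 (h.symm.trans (wordEq_nor k u)))

theorem IsNormalWord.nor_eq {u : List X} (h : IsNormalWord k r u) : nor k r u = u :=
  (nor_unique h (wordPoly_sub_mem_iff.2 (WordEq.refl r u))).symm

theorem IsNormalWord.eq_of_wordEq {u v : List X} (hu : IsNormalWord k r u)
    (hv : IsNormalWord k r v) (h : WordEq r u v) : u = v := by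
  rw [← hu.nor_eq, ← hv.nor_eq, nor_eq_of_wordEq h]

theorem nor_degLexLT {u : List X} (hu : ¬ IsNormalWord k r u) : DegLexLT (nor k r u) u := by
  rcases degLexLT_trichotomous (nor k r u) u with h | h | h
  · exact h
  · exact absurd (h ▸ isNormalWord_nor u) hu
  · exact absurd h ((isNormalWord_nor u).not_degLexLT (wordEq_nor k u).symm)

theorem IsSolution.length_nor (hr : IsSolution r) (u : List X) :
    (nor k r u).length = u.length :=
  (hr.length_eq (wordEq_nor k u)).symm

theorem IsSolution.nor_mem (hr : IsSolution r) {u : List X} {m : ℕ} (h : u.length = m) :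
    nor k r u ∈ normalWords k r m :=
  ⟨isNormalWord_nor u, (hr.length_nor u).trans h⟩

/-- The normal words of length `m` are in bijection with the commutative words of length `m`. -/
noncomputable def IsSolution.normalWordsEquiv (k : Type*) [Field k] {X : Type*} [LinearOrder X]
    [Finite X] {r : X × X → X × X} (hr : IsSolution r) (m : ℕ) :
    normalWords k r m ≃ Sym X m :=
  Equiv.ofBijective
    (fun u => ⟨(shadow r u.1 : Multiset X), by simpa using u.2.2⟩) (by
      constructor
      · intro u v h
        have h1 : (shadow r u.1 : Multiset X) = shadow r v.1 := congrArg Subtype.val h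
        exact Subtype.ext (u.2.1.eq_of_wordEq v.2.1 (hr.wordEq_iff.2 (Multiset.coe_eq_coe.1 h1)))
      · rintro ⟨s, hs⟩
        induction s using Quotient.inductionOn with
        | _ l =>
          have hl : shadow r (hr.unshadow 1 l) = l := by
            rw [hr.shadow_unshadow]
            simp
          refine ⟨⟨nor k r (hr.unshadow 1 l), hr.nor_mem ?_⟩, Subtype.ext ?_⟩
          · rw [← length_shadow r, hl]
            exact hs
          · refine Multiset.coe_eq_coe.2 ?_
            exact (hr.shadow_perm (wordEq_nor k _).symm).trans (List.Perm.of_eq hl))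

theorem IsSolution.finite_normalWords (k : Type*) [Field k] {X : Type*} [LinearOrder X]
    [Finite X] {r : X × X → X × X} (hr : IsSolution r) (m : ℕ) :
    (normalWords k r m).Finite := by
  classical
  cases nonempty_fintype X
  exact Set.finite_coe_iff.1 (Finite.of_equiv _ (hr.normalWordsEquiv k m).symm)

theorem IsSolution.ncard_normalWords (k : Type*) [Field k] {X : Type*} [LinearOrder X]
    [Fintype X] {r : X × X → X × X} (hr : IsSolution r) (m : ℕ) :
    (normalWords k r m).ncard = (Fintype.card X + m - 1).choose m := by
  classical
  rw [← Nat.card_coe_set_eq, Nat.card_congr (hr.normalWordsEquiv k m), Nat.card_eq_fintype_card,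
    Sym.card_sym_eq_choose]

end Normal

/-! ### Blocks of words: solutions on the words of a fixed length -/

/-- An involutive left nondegenerate right surjective map on a finite set is a solution as soon
as the left action respects `xy = (ˣy)(xʸ)`. -/
theorem isSolution_of_left_comp {Y : Type*} [Finite Y] {r : Y × Y → Y × Y}
    (hinv : Function.Involutive r) (hl : ∀ x, Function.Injective fun y => (r (x, y)).1)
    (hright : ∀ y, Function.Surjective fun x => (r (x, y)).2)
    (hc : ∀ x y z, (r ((r (x, y)).1, (r ((r (x, y)).2, z)).1)).1 = (r (x, (r (y, z)).1)).1) :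
    IsSolution r := by
  refine ⟨hinv, fun x => Finite.injective_iff_bijective.1 (hl x),
    fun y => Finite.surjective_iff_bijective.1 (hright y), ?_⟩
  -- `J` is the shadow of `xyz`. It is injective, and it turns `r₁₂` and `r₂₃` into the
  -- transpositions of coordinates, for which the braid relation is obvious.
  let J : Y × Y × Y → Y × Y × Y :=
    fun t => (t.1, (r (t.1, t.2.1)).1, (r (t.1, (r (t.2.1, t.2.2)).1)).1)
  have hs : ∀ x y, (r ((r (x, y)).1, (r (x, y)).2)).1 = x :=
    fun x y => congrArg Prod.fst (hinv (x, y))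
  have hJ : Function.Injective J := by
    rintro ⟨x, y, z⟩ ⟨x', y', z'⟩ h
    simp only [J, Prod.mk.injEq] at h
    obtain ⟨rfl, h1, h2⟩ := h
    obtain rfl := hl x h1
    obtain rfl := hl y (hl x h2)
    rfl
  have h12 : ∀ t, J (braid12 r t) = ((J t).2.1, (J t).1, (J t).2.2) := by
    rintro ⟨x, y, z⟩
    simp only [J, braid12, hs, hc]
  have h23 : ∀ t, J (braid23 r t) = ((J t).1, (J t).2.2, (J t).2.1) := by
    rintro ⟨x, y, z⟩
    simp only [J, braid23, hs]
  funext t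
  apply hJ
  simp only [Function.comp_apply, h12, h23]

/-- The words `w i` represent the classes of the words of length `d`, and `rY` is the map
`(a, b) ↦ (ᵃb, aᵇ)` on these classes. -/
structure IsBlockSolution {X Y : Type*} (r : X × X → X × X) (d : ℕ) (w : Y → List X)
    (rY : Y × Y → Y × Y) : Prop where
  length_eq : ∀ i, (w i).length = d
  eq_of_wordEq : ∀ i j, WordEq r (w i) (w j) → i = j
  exists_wordEq : ∀ u : List X, u.length = d → ∃ i, WordEq r u (w i)
  left : ∀ i j, WordEq r (w (rY (i, j)).1) (leftWord r (w i) (w j))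
  right : ∀ i j, WordEq r (w (rY (i, j)).2) (rightWord r (w i) (w j))

namespace IsBlockSolution

variable {X Y : Type*} {r : X × X → X × X} {d : ℕ} {w : Y → List X} {rY : Y × Y → Y × Y}

theorem mul_eq (h : IsBlockSolution r d w rY) (i j : Y) :
    WordEq r (w i ++ w j) (w (rY (i, j)).1 ++ w (rY (i, j)).2) :=
  (wordEq_leftWord_rightWord r _ _).trans ((h.left i j).symm.append (h.right i j).symm)

/-- Every property is checked on classes of words. Involutivity comes from `leftWord_of_wordEq` and
cancellation, left injectivity from shadows, right surjectivity from `exists_rightWord`; the left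
action respects the relation because `ᵃ(ᵇc)` depends only on the class of `ab`. -/
theorem isSolution [Finite Y] (hr : IsSolution r) (h : IsBlockSolution r d w rY) :
    IsSolution rY := by
  refine isSolution_of_left_comp ?_ ?_ ?_ ?_
  · rintro ⟨i, j⟩
    have h1 : (rY (rY (i, j))).1 = i :=
      h.eq_of_wordEq _ _ ((h.left _ _).trans (hr.leftWord_of_wordEq (h.mul_eq i j) (h.left i j)))
    have h2 := ((h.mul_eq i j).trans (h.mul_eq _ _)).symm
    rw [Prod.mk.eta, h1] at h2
    exact Prod.ext h1 (h.eq_of_wordEq _ _ (hr.wordEq_append_left_iff.1 h2))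
  · intro i j j' hj
    have h1 := (h.left i j).symm
    simp only at hj
    rw [hj] at h1
    exact h.eq_of_wordEq _ _ (hr.wordEq_of_leftWord (h1.trans (h.left i j')))
  · intro j t
    obtain ⟨a, ha⟩ := hr.exists_rightWord (w t) (w j)
    obtain ⟨i, hi⟩ := h.exists_wordEq a (by
      rw [← length_rightWord r a (w j), ha, h.length_eq])
    refine ⟨i, h.eq_of_wordEq _ _ ?_⟩
    have h1 := (h.right i j).trans (hr.rightWord_congr hi.symm (WordEq.refl r (w j)))
    rwa [ha] at h1
  · intro x y z
    apply h.eq_of_wordEq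
    have e : ∀ a b c, WordEq r (w (rY (a, (rY (b, c)).1)).1)
        (leftWord r (w a ++ w b) (w c)) := by
      intro a b c
      have := (h.left a (rY (b, c)).1).trans
        (hr.leftWord_congr (WordEq.refl r (w a)) (h.left b c))
      simpa only [leftWord, List.foldr_append] using this
    exact (e _ _ _).trans ((hr.leftWord_congr (h.mul_eq x y).symm (WordEq.refl r _)).trans
      (e _ _ _).symm)

/-- The Veronese map `y_i ↦ w_i`. -/
noncomputable def veroneseMap (k : Type*) [Field k] (h : IsBlockSolution r d w rY) :
    YBAlgebra k rY →ₐ[k] YBAlgebra k r :=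
  ybLift k rY (fun i => ybWord k r (w i)) fun i j => by
    rw [← ybWord_append, ← ybWord_append]
    exact (h.mul_eq i j).ybWord_eq k

/-! ### The Veronese map on words, and cutting words into blocks -/

variable {k : Type*} [Field k]

theorem veroneseMap_ybWord (h : IsBlockSolution r d w rY) (s : List Y) :
    h.veroneseMap k (ybWord k rY s) = ybWord k r (s.flatMap w) := by
  rw [veroneseMap, ybLift_ybWord]
  induction s with
  | nil => rfl
  | cons i s ih => rw [List.map_cons, List.prod_cons, ih, List.flatMap_cons, ybWord_append]

theorem length_flatMap (h : IsBlockSolution r d w rY) (s : List Y) :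
    (s.flatMap w).length = s.length * d := by
  induction s with
  | nil => simp
  | cons i s ih =>
    rw [List.flatMap_cons, List.length_append, ih, h.length_eq, List.length_cons]
    ring

/-- The index of the class of a word of length `d`. -/
noncomputable def index [Nonempty Y] (r : X × X → X × X) (w : Y → List X) (u : List X) : Y :=
  Classical.epsilon fun i => WordEq r u (w i)

theorem wordEq_index [Nonempty Y] (h : IsBlockSolution r d w rY) {u : List X}
    (hu : u.length = d) : WordEq r u (w (index r w u)) :=
  Classical.epsilon_spec (h.exists_wordEq u hu)

/-- The indices of the first `m` blocks of length `d` of a word. -/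
noncomputable def blocks [Nonempty Y] (r : X × X → X × X) (d : ℕ) (w : Y → List X) :
    ℕ → List X → List Y
  | 0, _ => []
  | m + 1, u => index r w (u.take d) :: blocks r d w m (u.drop d)

variable [Nonempty Y]

theorem wordEq_blocks (h : IsBlockSolution r d w rY) (m : ℕ) (u : List X)
    (hu : u.length = m * d) : WordEq r u ((blocks r d w m u).flatMap w) := by
  induction m generalizing u with
  | zero =>
    obtain rfl : u = [] := List.length_eq_zero_iff.1 (by simpa using hu)
    exact WordEq.refl _ _
  | succ m ih =>
    rw [Nat.succ_mul] at hu
    have h1 : WordEq r (u.take d) (w (index r w (u.take d))) :=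
      h.wordEq_index (by simp [hu])
    have h2 := ih (u.drop d) (by simp [hu])
    have h3 := h1.append h2
    rwa [List.take_append_drop] at h3

theorem blocks_flatMap (h : IsBlockSolution r d w rY) (s : List Y) :
    blocks r d w s.length (s.flatMap w) = s := by
  induction s with
  | nil => rfl
  | cons i s ih =>
    rw [List.length_cons, List.flatMap_cons, blocks, List.take_left' (h.length_eq i),
      List.drop_left' (h.length_eq i), ih]
    congr 1
    exact (h.eq_of_wordEq _ _ (h.wordEq_index (h.length_eq i))).symm

/-! ### Homomorphisms that factor through the Veronese map -/

variable {T : Type*} [Ring T] {π : YBAlgebra k rY →+* T}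

/-- Only the first two block indices can change, and the two pairs of indices spell equal words in
`X`, which is the situation of `hπ`. -/
theorem map_blocks_append (h : IsBlockSolution r d w rY)
    (hπ : ∀ i j i' j', WordEq r (w i ++ w j) (w i' ++ w j') →
      π (ybWord k rY [i, j]) = π (ybWord k rY [i', j'])) (m : ℕ) {p p' c : List X}
    (hp : WordEq r p p') (hl : p.length = d + d) (hl' : p'.length = d + d) :
    π (ybWord k rY (blocks r d w (m + 2) (p ++ c))) =
      π (ybWord k rY (blocks r d w (m + 2) (p' ++ c))) := by
  have e : ∀ q : List X, q.length = d + d → blocks r d w (m + 2) (q ++ c) =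
      [index r w (q.take d), index r w (q.drop d)] ++ blocks r d w m c := by
    intro q hq
    have h1 : d ≤ q.length := by omega
    have h2 : (q.drop d).length = d := by simp [hq]
    rw [blocks, blocks, List.take_append_of_le_length h1, List.drop_append_of_le_length h1,
      List.take_left' h2, List.drop_left' h2]
    rfl
  have e' : ∀ q : List X, q.length = d + d →
      WordEq r q (w (index r w (q.take d)) ++ w (index r w (q.drop d))) := by
    intro q hq
    have h3 := (h.wordEq_index (u := q.take d) (by simp [hq])).append
      (h.wordEq_index (u := q.drop d) (by simp [hq]))
    rwa [List.take_append_drop] at h3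
  rw [e p hl, e p' hl', ybWord_append, ybWord_append, map_mul, map_mul,
    hπ _ _ _ _ (((e' p hl).symm.trans hp).trans (e' p' hl'))]

/-- Two adjacent letters meet at most two consecutive blocks. Blocks before them are peeled off by
induction; then the change lies in the only block, whose index depends just on its class, or in the
first two blocks. -/
theorem map_blocks_step (hr : IsSolution r) (h : IsBlockSolution r d w rY) (hd : 2 ≤ d)
    (hπ : ∀ i j i' j', WordEq r (w i ++ w j) (w i' ++ w j') →
      π (ybWord k rY [i, j]) = π (ybWord k rY [i', j'])) (m : ℕ) {u v : List X}
    (huv : WordStep r u v) (hu : u.length = m * d) :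
    π (ybWord k rY (blocks r d w m u)) = π (ybWord k rY (blocks r d w m v)) := by
  induction m generalizing u v with
  | zero => rfl
  | succ m ih =>
    have hE : WordEq r u v := Relation.EqvGen.rel _ _ huv
    have hv : v.length = (m + 1) * d := (hr.length_eq hE).symm.trans hu
    obtain ⟨a, x, y, b⟩ := huv
    by_cases ha : d ≤ a.length
    · have hl : (a.drop d ++ x :: y :: b).length = m * d := by
        simp only [List.length_append, List.length_drop, List.length_cons, Nat.add_mul,
          one_mul] at hu ⊢
        omega
      have e : ∀ u : List X, ybWord k rY (blocks r d w (m + 1) u) =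
          ybWord k rY [index r w (u.take d)] * ybWord k rY (blocks r d w m (u.drop d)) :=
        fun u => ybWord_cons _ _
      rw [e, e, map_mul, map_mul,
        List.take_append_of_le_length ha, List.take_append_of_le_length ha,
        List.drop_append_of_le_length ha, List.drop_append_of_le_length ha,
        ih (WordStep.mk (a.drop d) x y b) hl]
    · cases m with
      | zero =>
        rw [zero_add, one_mul] at hu hv
        simp only [blocks]
        rw [List.take_of_length_le hu.le, List.take_of_length_le hv.le]
        congr 3
        exact h.eq_of_wordEq _ _ (((h.wordEq_index hu).symm.trans hE).trans (h.wordEq_index hv))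
      | succ m =>
        simp only [List.length_append, List.length_cons, Nat.succ_mul] at hu
        -- `b₁` completes `a x y` to exactly two blocks; there is room for `x y` because `a` is
        -- shorter than `d`.
        obtain ⟨b₁, b₂, rfl, hb⟩ : ∃ b₁ b₂, b = b₁ ++ b₂ ∧ b₁.length = d + d - a.length - 2 :=
          ⟨b.take (d + d - a.length - 2), b.drop _, (List.take_append_drop _ _).symm, by
            rw [List.length_take]; omega⟩
        have e : ∀ x y : X, a ++ x :: y :: (b₁ ++ b₂) = (a ++ x :: y :: b₁) ++ b₂ := by simp
        rw [e, e]
        refine h.map_blocks_append hπ m (Relation.EqvGen.rel _ _ (WordStep.mk a x y b₁)) ?_ ?_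
        all_goals
          simp only [List.length_append, List.length_cons, hb]
          omega

theorem map_blocks_eq (hr : IsSolution r) (h : IsBlockSolution r d w rY) (hd : 2 ≤ d)
    (hπ : ∀ i j i' j', WordEq r (w i ++ w j) (w i' ++ w j') →
      π (ybWord k rY [i, j]) = π (ybWord k rY [i', j'])) (m : ℕ) {u v : List X}
    (huv : WordEq r u v) (hu : u.length = m * d) :
    π (ybWord k rY (blocks r d w m u)) = π (ybWord k rY (blocks r d w m v)) := by
  induction huv with
  | rel _ _ h1 => exact h.map_blocks_step hr hd hπ m h1 hu
  | refl => rfl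
  | symm _ _ h1 ih => exact (ih ((hr.length_eq h1).trans hu)).symm
  | trans _ _ _ h1 _ ih ih' => exact (ih hu).trans (ih' ((hr.length_eq h1).symm.trans hu))

theorem map_ybWord_eq (hr : IsSolution r) (h : IsBlockSolution r d w rY) (hd : 2 ≤ d)
    (hπ : ∀ i j i' j', WordEq r (w i ++ w j) (w i' ++ w j') →
      π (ybWord k rY [i, j]) = π (ybWord k rY [i', j'])) {s t : List Y}
    (hst : WordEq r (s.flatMap w) (t.flatMap w)) :
    π (ybWord k rY s) = π (ybWord k rY t) := by
  have hl := hr.length_eq hst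
  rw [h.length_flatMap, h.length_flatMap] at hl
  have hl' : s.length = t.length := Nat.eq_of_mul_eq_mul_right (by omega) hl
  have := h.map_blocks_eq hr hd hπ s.length hst (h.length_flatMap s)
  rw [h.blocks_flatMap] at this
  rwa [hl', h.blocks_flatMap] at this

/-- A homomorphism that identifies the quadratic words with equal Veronese images kills the kernel
of the Veronese map. -/
theorem map_eq_zero (hr : IsSolution r) (h : IsBlockSolution r d w rY) (hd : 2 ≤ d)
    (hπ : ∀ i j i' j', WordEq r (w i ++ w j) (w i' ++ w j') →
      π (ybWord k rY [i, j]) = π (ybWord k rY [i', j'])) {a : YBAlgebra k rY}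
    (ha : h.veroneseMap k a = 0) : π a = 0 := by
  let φ : List Y → (wordCon r).Quotient := fun s => wordClass r (s.flatMap w)
  -- `Λ` sends a class to a chosen word in `Y` spelling it; on classes that no such word spells, the
  -- value is arbitrary and plays no role. Since `π` depends only on the class spelled, `π ∘ Λ`
  -- recovers `π` from the Veronese image.
  let Λ : MonoidAlgebra k (wordCon r).Quotient →ₗ[k] YBAlgebra k rY :=
    (Finsupp.linearCombination k fun c => ybWord k rY (Function.invFun φ c)) ∘ₗ
      (MonoidAlgebra.coeffLinearEquiv k).toLinearMap
  have key : ∀ a, π a = π (Λ (ybToMonoid k r (h.veroneseMap k a))) := by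
    intro a
    induction a using ybWord_induction with
    | h0 => simp
    | hw s =>
      rw [veroneseMap_ybWord, ybToMonoid_ybWord]
      have e : Λ (MonoidAlgebra.single (wordClass r (s.flatMap w)) 1) =
          ybWord k rY (Function.invFun φ (φ s)) := by
        simp [Λ, φ]
      rw [e]
      refine h.map_ybWord_eq hr hd hπ (wordClass_eq_iff.1 ?_)
      exact (Function.invFun_eq (f := φ) ⟨s, rfl⟩).symm
    | hadd a b iha ihb => simp only [map_add, ← iha, ← ihb]
    | hs c a iha =>
      -- `π` is only a ring homomorphism, so scalars are written as factors.
      have e : ∀ (c : k) (b : YBAlgebra k rY), c • b = algebraMap k (YBAlgebra k rY) c * b :=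
        fun c b => Algebra.smul_def c b
      simp only [map_smul]
      rw [e, e, map_mul, map_mul, ← iha]
  rw [key, ha, map_zero, map_zero, map_zero]

/-- A word of length `md` equals the product of the representatives of its `m` blocks. -/
theorem range_veroneseMap (h : IsBlockSolution r d w rY) :
    (h.veroneseMap k).range = veroneseSubalgebra k r d := by
  apply le_antisymm
  · rintro _ ⟨a, rfl⟩
    change h.veroneseMap k a ∈ ⨆ m : ℕ, ybComponent k r (m * d)
    induction a using ybWord_induction with
    | h0 => rw [map_zero]; exact Submodule.zero_mem _
    | hw s =>
      rw [veroneseMap_ybWord]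
      exact Submodule.mem_iSup_of_mem s.length
        (Submodule.subset_span ⟨_, h.length_flatMap s, rfl⟩)
    | hadd a b iha ihb => rw [map_add]; exact Submodule.add_mem _ iha ihb
    | hs c a iha => rw [map_smul]; exact Submodule.smul_mem _ c iha
  · have hle : (⨆ m : ℕ, ybComponent k r (m * d)) ≤
        Subalgebra.toSubmodule (h.veroneseMap k).range := by
      refine iSup_le fun m => Submodule.span_le.2 ?_
      rintro _ ⟨u, hu, rfl⟩
      exact ⟨ybWord k rY (blocks r d w m u), by
        refine (h.veroneseMap_ybWord _).trans ?_
        exact ((h.wordEq_blocks m u hu).ybWord_eq k).symm⟩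
    exact fun x hx => hle hx

end IsBlockSolution

/-! ### Coefficients in the Yang–Baxter algebra -/

section Coefficients

variable {k X : Type*} [Field k] {r : X × X → X × X}

/-- The coefficient of the class of the word `u` in an element of `A(k, X, r)`. -/
noncomputable def classCoeff (k : Type*) {X : Type*} [Field k] (r : X × X → X × X) (u : List X) :
    YBAlgebra k r →ₗ[k] k :=
  (Finsupp.lapply (wordClass r u) ∘ₗ (MonoidAlgebra.coeffLinearEquiv k).toLinearMap) ∘ₗ
    (ybToMonoid k r).toLinearMap

theorem classCoeff_apply (u : List X) (a : YBAlgebra k r) :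
    classCoeff k r u a = (ybToMonoid k r a).coeff (wordClass r u) := rfl

theorem classCoeff_of_wordEq {u v : List X} (h : WordEq r v u) :
    classCoeff k r u (ybWord k r v) = 1 := by
  classical
  rw [classCoeff_apply, ybToMonoid_ybWord, wordClass_eq_iff.2 h]
  simp

theorem classCoeff_of_not_wordEq {u v : List X} (h : ¬ WordEq r v u) :
    classCoeff k r u (ybWord k r v) = 0 := by
  classical
  rw [classCoeff_apply, ybToMonoid_ybWord]
  have : wordClass r v ≠ wordClass r u := fun e => h (wordClass_eq_iff.1 e)
  simp [this]

/-- By linearity in `a` and `b` it suffices to take words, and then the product is a single word. -/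
theorem classCoeff_mul_mul {u x : List X} (h : ∀ s t, ¬ WordEq r (s ++ x ++ t) u)
    (a b : YBAlgebra k r) : classCoeff k r u (a * ybWord k r x * b) = 0 := by
  induction a using ybWord_induction with
  | h0 => simp
  | hadd a a' iha iha' => rw [add_mul, add_mul, map_add, iha, iha', add_zero]
  | hs c a iha => rw [smul_mul_assoc, smul_mul_assoc, map_smul, iha, smul_zero]
  | hw s =>
    induction b using ybWord_induction with
    | h0 => simp
    | hadd b b' ihb ihb' => rw [mul_add, map_add, ihb, ihb', add_zero]
    | hs c b ihb => rw [mul_smul_comm, map_smul, ihb, smul_zero]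
    | hw t =>
      rw [← ybWord_append, ← ybWord_append]
      exact classCoeff_of_not_wordEq (h s t)

end Coefficients

/-! ### Auxiliary facts on lists -/

theorem List.perm_pair_iff {α : Type*} {a b c d : α} :
    [a, b].Perm [c, d] ↔ a = c ∧ b = d ∨ a = d ∧ b = c := by
  constructor
  · intro h
    have ha : a ∈ [c, d] := h.subset (by simp)
    rcases List.mem_pair.1 ha with rfl | rfl
    · exact Or.inl ⟨rfl, by simpa using h⟩
    · exact Or.inr ⟨rfl, by simpa using h.trans (List.Perm.swap _ _ _)⟩
  · rintro (⟨rfl, rfl⟩ | ⟨rfl, rfl⟩)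
    · exact List.Perm.refl _
    · exact List.Perm.swap _ _ _

theorem List.Lex.append_of_length_eq {α : Type*} {s : α → α → Prop} {u v : List α}
    (h : List.Lex s u v) (hl : u.length = v.length) (a b : List α) :
    List.Lex s (u ++ a) (v ++ b) := by
  induction h with
  | nil => simp at hl
  | cons _ ih => exact List.Lex.cons (ih (by simpa using hl))
  | rel h => exact List.Lex.rel h

/-! ### Quadratic words in a solution -/

section Quadratic

variable {Y : Type*} {s : Y × Y → Y × Y}

/-- A pair `(a, b)` is determined by its shadow `(a, ᵃb)`. -/
theorem IsSolution.pair_ext (hs : IsSolution s) {p q : Y × Y} (h : p.1 = q.1)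
    (h' : (s p).1 = (s q).1) : p = q := by
  obtain ⟨a, b⟩ := p
  obtain ⟨c, d⟩ := q
  obtain rfl : a = c := h
  exact Prod.ext rfl ((hs.left_nondegenerate a).1 h')

theorem IsSolution.pair_eq_or_of_perm (hs : IsSolution s) {p q : Y × Y}
    (h : p.1 = q.1 ∧ (s p).1 = (s q).1 ∨ p.1 = (s q).1 ∧ (s p).1 = q.1) : p = q ∨ p = s q := by
  rcases h with h | h
  · exact Or.inl (hs.pair_ext h.1 h.2)
  · exact Or.inr (hs.pair_ext h.1 (by rw [hs.involutive]; exact h.2))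

theorem IsSolution.pair_eq_or_of_wordEq (hs : IsSolution s) {p q : Y × Y}
    (h : WordEq s [p.1, p.2] [q.1, q.2]) : p = q ∨ p = s q := by
  have := hs.shadow_perm h
  simp only [shadow_cons, shadow_nil, List.map_nil, List.map_cons, List.perm_pair_iff] at this
  exact hs.pair_eq_or_of_perm this

/-- A set that meets every orbit of an involutive nondegenerate map exactly once has as many
elements as there are unordered pairs. -/
theorem IsSolution.ncard_transversal [Fintype Y] (hs : IsSolution s) {P : Set (Y × Y)}
    (h1 : ∀ p, p ∈ P ∨ s p ∈ P) (h2 : ∀ p, p ∈ P → s p ∈ P → s p = p) :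
    P.ncard = (Fintype.card Y + 1).choose 2 := by
  classical
  -- The shadow of a pair, taken as an unordered pair: it is constant on the orbits of `s` and
  -- separates them.
  let f : Y × Y → Sym2 Y := fun p => s(p.1, (s p).1)
  have hinj : Set.InjOn f P := by
    intro p hp q hq h
    rcases hs.pair_eq_or_of_perm (Sym2.eq_iff.1 h) with h | rfl
    · exact h
    · exact h2 q hq hp
  have himg : f '' P = Set.univ := by
    refine Set.eq_univ_of_forall fun z => ?_
    induction z using Sym2.inductionOn with
    | _ a b =>
      obtain ⟨c, hc⟩ := (hs.left_nondegenerate a).2 b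
      rcases h1 (a, c) with h | h
      · exact ⟨_, h, congrArg (fun y => s(a, y)) hc⟩
      · refine ⟨_, h, ?_⟩
        change s((s (a, c)).1, (s (s (a, c))).1) = s(a, b)
        rw [hs.involutive, Sym2.eq_swap]
        exact congrArg (fun y => s(a, y)) hc
  rw [← hinj.ncard_image, himg, Set.ncard_univ, Nat.card_eq_fintype_card, Sym2.card]

end Quadratic

/-! ### The normalized Veronese solution -/

section Veronese

variable {k X : Type*} [Field k] [LinearOrder X] {r : X × X → X × X} {d N : ℕ}
  {w : Fin N → List X}

namespace IsNormalEnumeration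

theorem mem (hw : IsNormalEnumeration k r d w) (i : Fin N) : w i ∈ normalWords k r d :=
  hw.1 ▸ Set.mem_range_self i

theorem length_eq (hw : IsNormalEnumeration k r d w) (i : Fin N) : (w i).length = d := (hw.mem i).2

theorem exists_eq (hw : IsNormalEnumeration k r d w) {u : List X} (hu : u ∈ normalWords k r d) :
    ∃ i, w i = u := by
  rwa [← hw.1] at hu

theorem degLexLT_append (hw : IsNormalEnumeration k r d w) {i i' : Fin N} (h : i < i')
    (j j' : Fin N) : DegLexLT (w i ++ w j) (w i' ++ w j') :=
  List.Shortlex.of_lex (by simp [hw.length_eq])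
    ((hw.2 i i' h).append_of_length_eq (by simp [hw.length_eq]) _ _)

theorem degLexLT_append_left (hw : IsNormalEnumeration k r d w) (i : Fin N) {j j' : Fin N}
    (h : j < j') : DegLexLT (w i ++ w j) (w i ++ w j') :=
  List.Shortlex.append_left (List.Shortlex.of_lex (by simp [hw.length_eq]) (hw.2 j j' h)) _

/-- All `w i` have the same length and increase with `i`, so comparing `w_i w_j` amounts to
comparing `(i, j)` lexicographically. -/
theorem degLexLT_pair (hw : IsNormalEnumeration k r d w) {p q : Fin N × Fin N}
    (h : DegLexLT (w p.1 ++ w p.2) (w q.1 ++ w q.2)) : DegLexLT [p.1, p.2] [q.1, q.2] := by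
  obtain ⟨a, b⟩ := p
  obtain ⟨c, e⟩ := q
  simp only at h
  refine List.Shortlex.of_lex rfl ?_
  rcases lt_trichotomy a c with h1 | rfl | h1
  · exact List.Lex.rel h1
  · rcases lt_trichotomy b e with h2 | rfl | h2
    · exact List.Lex.cons (List.Lex.rel h2)
    · exact absurd h (degLexLT_asymm h)
    · exact absurd h (degLexLT_asymm (hw.degLexLT_append_left a h2))
  · exact absurd h (degLexLT_asymm (hw.degLexLT_append h1 _ _))

theorem injective (hw : IsNormalEnumeration k r d w) : Function.Injective w := by
  intro i j h
  rcases lt_trichotomy i j with h1 | h1 | h1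
  · exact absurd (h ▸ hw.2 i j h1) (List.lt_irrefl (w i))
  · exact h1
  · exact absurd (h ▸ hw.2 j i h1) (List.lt_irrefl (w i))

theorem append_injective (hw : IsNormalEnumeration k r d w) {p q : Fin N × Fin N}
    (h : w p.1 ++ w p.2 = w q.1 ++ w q.2) : p = q := by
  obtain ⟨h1, h2⟩ := List.append_inj h (by simp [hw.length_eq])
  exact Prod.ext (hw.injective h1) (hw.injective h2)

end IsNormalEnumeration

theorem IsSolution.exists_isNormalEnumeration [Fintype X] (hr : IsSolution r)
    (hN : N = (Fintype.card X + d - 1).choose d) :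
    ∃ w : Fin N → List X, IsNormalEnumeration k r d w := by
  have hc : (hr.finite_normalWords k d).toFinset.card = N := by
    rw [← Set.ncard_eq_toFinset_card _ (hr.finite_normalWords k d), hr.ncard_normalWords k, hN]
  refine ⟨(hr.finite_normalWords k d).toFinset.orderEmbOfFin hc, ?_, fun i j h => ?_⟩
  · rw [Finset.range_orderEmbOfFin, Set.Finite.coe_toFinset]
  · exact ((hr.finite_normalWords k d).toFinset.orderEmbOfFin hc).strictMono h

variable [Finite X]

theorem IsNormalEnumeration.exists_isVeroneseSolution (hr : IsSolution r)
    (hw : IsNormalEnumeration k r d w) :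
    ∃ rY : Fin N × Fin N → Fin N × Fin N, IsVeroneseSolution k r w rY := by
  have h : ∀ p : Fin N × Fin N, ∃ q : Fin N × Fin N,
      rho k r (w p.1, w p.2) = (w q.1, w q.2) := by
    intro p
    obtain ⟨i, hi⟩ := hw.exists_eq (u := nor k r (leftWord r (w p.1) (w p.2)))
      (hr.nor_mem (by simp [hw.length_eq]))
    obtain ⟨j, hj⟩ := hw.exists_eq (u := nor k r (rightWord r (w p.1) (w p.2)))
      (hr.nor_mem (by simp [hw.length_eq]))
    exact ⟨(i, j), by rw [hi, hj]; rfl⟩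
  choose rY hY using h
  refine ⟨rY, fun j i i' j' => ⟨fun h => ?_, fun h => ?_⟩⟩
  · have := hY (j, i)
    rwa [h] at this
  · have h' := (hY (j, i)).symm.trans h
    exact Prod.ext (hw.injective (congrArg Prod.fst h')) (hw.injective (congrArg Prod.snd h'))

variable {rY : Fin N × Fin N → Fin N × Fin N}

theorem IsVeroneseSolution.rho_eq (hY : IsVeroneseSolution k r w rY) (p : Fin N × Fin N) :
    rho k r (w p.1, w p.2) = (w (rY p).1, w (rY p).2) :=
  (hY p.1 p.2 _ _).1 rfl

theorem IsVeroneseSolution.isBlockSolution (hr : IsSolution r)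
    (hw : IsNormalEnumeration k r d w) (hY : IsVeroneseSolution k r w rY) :
    IsBlockSolution r d w rY where
  length_eq := hw.length_eq
  eq_of_wordEq i j h := hw.injective ((hw.mem i).1.eq_of_wordEq (hw.mem j).1 h)
  exists_wordEq u hu := by
    obtain ⟨i, hi⟩ := hw.exists_eq (hr.nor_mem (k := k) hu)
    exact ⟨i, hi ▸ wordEq_nor k u⟩
  left i j := by
    have h : nor k r (leftWord r (w i) (w j)) = w (rY (i, j)).1 :=
      congrArg Prod.fst (hY.rho_eq (i, j))
    exact h ▸ (wordEq_nor k _).symm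
  right i j := by
    have h : nor k r (rightWord r (w i) (w j)) = w (rY (i, j)).2 :=
      congrArg Prod.snd (hY.rho_eq (i, j))
    exact h ▸ (wordEq_nor k _).symm

theorem IsVeroneseSolution.mem_setP_iff (hY : IsVeroneseSolution k r w rY) {p : Fin N × Fin N} :
    p ∈ setP k r w ↔ ¬ DegLexLT (w (rY p).1 ++ w (rY p).2) (w p.1 ++ w p.2) := by
  rw [setP, Set.mem_ofPred_eq, hY.rho_eq]

/-- `r_Y` exchanges the two sides of the comparison defining `P`. Together with `eq_of_mem_setP`,
this makes `P` a transversal of the orbits of `r_Y`. -/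
theorem mem_setP_or (hr : IsSolution r) (hw : IsNormalEnumeration k r d w)
    (hY : IsVeroneseSolution k r w rY)
    (p : Fin N × Fin N) : p ∈ setP k r w ∨ rY p ∈ setP k r w := by
  rw [hY.mem_setP_iff, hY.mem_setP_iff, ((hY.isBlockSolution hr hw).isSolution hr).involutive]
  by_contra! h
  exact degLexLT_asymm h.1 h.2

theorem eq_of_mem_setP (hr : IsSolution r) (hw : IsNormalEnumeration k r d w)
    (hY : IsVeroneseSolution k r w rY)
    {p : Fin N × Fin N} (h : p ∈ setP k r w) (h' : rY p ∈ setP k r w) :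
    rY p = p := by
  rw [hY.mem_setP_iff] at h h'
  rw [((hY.isBlockSolution hr hw).isSolution hr).involutive] at h'
  rcases degLexLT_trichotomous (w (rY p).1 ++ w (rY p).2) (w p.1 ++ w p.2) with h1 | h1 | h1
  · exact absurd h1 h
  · exact hw.append_injective h1
  · exact absurd h1 h'

theorem eq_of_wordEq_setP (hr : IsSolution r) (hw : IsNormalEnumeration k r d w)
    (hY : IsVeroneseSolution k r w rY)
    {p q : Fin N × Fin N} (hp : p ∈ setP k r w) (hq : q ∈ setP k r w)
    (h : WordEq rY [p.1, p.2] [q.1, q.2]) : p = q := by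
  rcases ((hY.isBlockSolution hr hw).isSolution hr).pair_eq_or_of_wordEq h with h | rfl
  · exact h
  · exact eq_of_mem_setP hr hw hY hq hp

/-- A normal word is the least of its class, so the condition defining `P` is automatic. -/
theorem mem_setC_iff (hr : IsSolution r) (hw : IsNormalEnumeration k r d w)
    (hY : IsVeroneseSolution k r w rY)
    {p : Fin N × Fin N} :
    p ∈ setC k r w ↔ IsNormalWord k r (w p.1 ++ w p.2) :=
  ⟨fun h => h.2, fun h => ⟨hY.mem_setP_iff.2
    (h.not_degLexLT ((hY.isBlockSolution hr hw).mul_eq p.1 p.2)), h⟩⟩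

/-- Both halves of a normal word of length `2d` are normal of length `d`, hence occur in the
enumeration. -/
theorem exists_setC_eq (hr : IsSolution r) (hw : IsNormalEnumeration k r d w)
    (hY : IsVeroneseSolution k r w rY)
    {u : List X} (hu : u ∈ normalWords k r (2 * d)) :
    ∃ q ∈ setC k r w, w q.1 ++ w q.2 = u := by
  obtain ⟨i, hi⟩ := hw.exists_eq (u := u.take d)
    ⟨hu.1.infix (List.take_prefix _ _).isInfix, by simp [hu.2]; omega⟩
  obtain ⟨j, hj⟩ := hw.exists_eq (u := u.drop d)
    ⟨hu.1.infix (List.drop_suffix _ _).isInfix, by simp [hu.2]; omega⟩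
  have h : w i ++ w j = u := by rw [hi, hj, List.take_append_drop]
  exact ⟨(i, j), (mem_setC_iff hr hw hY).2 (h.symm ▸ hu.1), h⟩

theorem exists_setC_eq_nor (hr : IsSolution r) (hw : IsNormalEnumeration k r d w)
    (hY : IsVeroneseSolution k r w rY)
    (p : Fin N × Fin N) :
    ∃ q ∈ setC k r w, w q.1 ++ w q.2 = nor k r (w p.1 ++ w p.2) :=
  exists_setC_eq hr hw hY (hr.nor_mem (by simp [hw.length_eq]; omega))

theorem existsUnique_isReduction (hr : IsSolution r) (hw : IsNormalEnumeration k r d w)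
    (hY : IsVeroneseSolution k r w rY)
    {p : Fin N × Fin N} (hp : p ∈ setMV k r w) :
    ∃! q, IsReduction k r w p q := by
  obtain ⟨q, hq, h⟩ := exists_setC_eq_nor hr hw hY p
  exact ⟨q, ⟨hp, hq, h⟩, fun q' h' => hw.append_injective (h'.2.2.trans h.symm)⟩

theorem ncard_setC (hr : IsSolution r) (hw : IsNormalEnumeration k r d w)
    (hY : IsVeroneseSolution k r w rY) : (setC k r w).ncard = (normalWords k r (2 * d)).ncard := by
  have h : (fun p : Fin N × Fin N => w p.1 ++ w p.2) '' setC k r w = normalWords k r (2 * d) := by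
    ext u
    constructor
    · rintro ⟨p, hp, rfl⟩
      exact ⟨hp.2, by simp [hw.length_eq]; omega⟩
    · exact fun hu => exists_setC_eq hr hw hY hu
  rw [← h, Set.InjOn.ncard_image fun p _ q _ h => hw.append_injective h]

end Veronese

/-! ### The kernel of the Veronese map -/

section Kernel

variable {k X : Type*} [Field k] [LinearOrder X] {r : X × X → X × X} {d N : ℕ}
  {w : Fin N → List X} [Finite X] {rY : Fin N × Fin N → Fin N × Fin N}

theorem IsReduction.degLexLT (hw : IsNormalEnumeration k r d w) {p q : Fin N × Fin N}
    (h : IsReduction k r w p q) : DegLexLT [q.1, q.2] [p.1, p.2] := by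
  apply hw.degLexLT_pair
  rw [h.2.2]
  exact nor_degLexLT h.1.2

theorem IsReduction.ne {p q p' q' : Fin N × Fin N} (h : IsReduction k r w p q)
    (h' : IsReduction k r w p' q') : q ≠ p' := by
  rintro rfl
  exact h'.1.2 h.2.1.2

theorem IsReduction.not_wordEq (hr : IsSolution r) (hw : IsNormalEnumeration k r d w)
    (hY : IsVeroneseSolution k r w rY) {p q p' q' : Fin N × Fin N} (h : IsReduction k r w p q)
    (h' : IsReduction k r w p' q') : ¬ WordEq rY [q.1, q.2] [p'.1, p'.2] :=
  fun he => h.ne h' (eq_of_wordEq_setP hr hw hY h.2.1.1 h'.1.1 he)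

theorem IsReduction.classCoeff_self (hr : IsSolution r) (hw : IsNormalEnumeration k r d w)
    (hY : IsVeroneseSolution k r w rY) {p q : Fin N × Fin N} (h : IsReduction k r w p q) :
    classCoeff k rY [p.1, p.2] (ybWord k rY [p.1, p.2] - ybWord k rY [q.1, q.2]) = 1 := by
  rw [map_sub, classCoeff_of_wordEq (WordEq.refl _ _),
    classCoeff_of_not_wordEq (h.not_wordEq hr hw hY h), sub_zero]

/-- In degree two, the ideal generated by the elements `γ_{p'}` with `p' ≠ p` does not involve
`p`. -/
theorem IsReduction.classCoeff_mul_mul_of_ne (hr : IsSolution r)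
    (hw : IsNormalEnumeration k r d w) (hY : IsVeroneseSolution k r w rY)
    {p q p' q' : Fin N × Fin N} (h : IsReduction k r w p q) (h' : IsReduction k r w p' q')
    (hne : p' ≠ p) (a b : YBAlgebra k rY) :
    classCoeff k rY [p.1, p.2]
      (a * (ybWord k rY [p'.1, p'.2] - ybWord k rY [q'.1, q'.2]) * b) = 0 := by
  have key : ∀ x : Fin N × Fin N, ¬ WordEq rY [x.1, x.2] [p.1, p.2] →
      classCoeff k rY [p.1, p.2] (a * ybWord k rY [x.1, x.2] * b) = 0 := by
    intro x hx
    refine classCoeff_mul_mul (fun s t he => hx ?_) a b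
    have hl := ((hY.isBlockSolution hr hw).isSolution hr).length_eq he
    simp only [List.length_append, List.length_cons, List.length_nil] at hl
    obtain rfl : s = [] := List.length_eq_zero_iff.1 (by omega)
    obtain rfl : t = [] := List.length_eq_zero_iff.1 (by omega)
    simpa using he
  rw [mul_sub, sub_mul, map_sub, key _ (h'.not_wordEq hr hw hY h), key _ fun he =>
    hne (eq_of_wordEq_setP hr hw hY h'.1.1 h.1.1 he), sub_zero]

/-- The coefficients at the classes of `y_i y_j`, for `(i, j) ∈ MV`, form a dual family to the
`γ_{ij}`. Indexing by `MV` also yields the number of relations, since an independent family is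
injective. -/
theorem exists_linearIndependent_kernelRelations (hr : IsSolution r)
    (hw : IsNormalEnumeration k r d w) (hY : IsVeroneseSolution k r w rY) :
    ∃ g : setMV k r w → YBAlgebra k rY, LinearIndependent k g ∧
      Set.range g = kernelRelations k r w rY := by
  classical
  choose red hred using fun p : setMV k r w => (existsUnique_isReduction hr hw hY p.2).exists
  refine ⟨fun p => ybWord k rY [p.1.1, p.1.2] - ybWord k rY [(red p).1, (red p).2], ?_, ?_⟩
  · rw [linearIndependent_iff']
    intro s c hc p hp
    have h := congrArg (classCoeff k rY [p.1.1, p.1.2]) hc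
    rw [map_sum, map_zero, Finset.sum_eq_single p] at h
    · rwa [map_smul, (hred p).classCoeff_self hr hw hY, smul_eq_mul, mul_one] at h
    · intro p' _ hne
      have := (hred p).classCoeff_mul_mul_of_ne hr hw hY (hred p')
        (fun e => hne (Subtype.ext e)) 1 1
      rw [one_mul, mul_one] at this
      rw [map_smul, this, smul_zero]
    · exact fun h => absurd hp h
  · ext z
    constructor
    · rintro ⟨p, rfl⟩
      exact ⟨p, red p, hred p, rfl⟩
    · rintro ⟨p, q, h, rfl⟩
      refine ⟨⟨p, h.1⟩, ?_⟩
      have e := (existsUnique_isReduction hr hw hY h.1).unique (hred ⟨p, h.1⟩) h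
      simp only [e]

/-- For the inclusion of the kernel, `map_eq_zero` is applied to the quotient by the ideal of the
relations; only quadratic words have to be compared there. -/
theorem span_kernelRelations [Nonempty X] (hr : IsSolution r) (hd : 2 ≤ d)
    (hw : IsNormalEnumeration k r d w) (hY : IsVeroneseSolution k r w rY) :
    TwoSidedIdeal.span (kernelRelations k r w rY) =
      TwoSidedIdeal.ker ((hY.isBlockSolution hr hw).veroneseMap k) := by
  have hB := hY.isBlockSolution hr hw
  apply le_antisymm
  · rw [TwoSidedIdeal.span_le]
    rintro _ ⟨p, q, h, rfl⟩
    rw [SetLike.mem_coe, TwoSidedIdeal.mem_ker, map_sub, sub_eq_zero, hB.veroneseMap_ybWord,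
      hB.veroneseMap_ybWord]
    refine WordEq.ybWord_eq k ?_
    simp only [List.flatMap_cons, List.flatMap_nil, List.append_nil, h.2.2]
    exact wordEq_nor k _
  · intro a ha
    rw [TwoSidedIdeal.mem_ker] at ha
    obtain ⟨i₀, -⟩ := hB.exists_wordEq (List.replicate d (Classical.arbitrary X)) (by simp)
    have : Nonempty (Fin N) := ⟨i₀⟩
    set K := TwoSidedIdeal.span (kernelRelations k r w rY) with hK
    have hmem : ∀ {a : YBAlgebra k rY}, K.ringCon.mk' a = 0 ↔ a ∈ K := by
      intro a
      rw [← map_zero K.ringCon.mk', TwoSidedIdeal.mem_iff]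
      exact RingCon.eq _
    have hP : ∀ p ∈ setP k r w, ∀ q ∈ setC k r w, w q.1 ++ w q.2 = nor k r (w p.1 ++ w p.2) →
        K.ringCon.mk' (ybWord k rY [p.1, p.2]) = K.ringCon.mk' (ybWord k rY [q.1, q.2]) := by
      intro p hp q hq h
      by_cases hn : IsNormalWord k r (w p.1 ++ w p.2)
      · rw [hn.nor_eq] at h
        rw [hw.append_injective h]
      · rw [← sub_eq_zero, ← map_sub, hmem]
        exact TwoSidedIdeal.subset_span ⟨p, q, ⟨⟨hp, hn⟩, hq, h⟩, rfl⟩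
    -- If `p ∉ P`, then `r_Y p ∈ P` is the same monomial of `A_Y` and has the same normal form in
    -- `A_X`.
    have hall : ∀ p : Fin N × Fin N, ∀ q ∈ setC k r w, w q.1 ++ w q.2 = nor k r (w p.1 ++ w p.2) →
        K.ringCon.mk' (ybWord k rY [p.1, p.2]) = K.ringCon.mk' (ybWord k rY [q.1, q.2]) := by
      intro p q hq h
      rcases mem_setP_or hr hw hY p with hp | hp
      · exact hP p hp q hq h
      · rw [ybWord_swap]
        exact hP _ hp q hq (h.trans (nor_eq_of_wordEq (hB.mul_eq p.1 p.2)))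
    let π : YBAlgebra k rY →+* K.ringCon.Quotient := K.ringCon.mk'
    have hπ : ∀ i j i' j', WordEq r (w i ++ w j) (w i' ++ w j') →
        π (ybWord k rY [i, j]) = π (ybWord k rY [i', j']) := by
      intro i j i' j' h
      obtain ⟨q, hq, hqn⟩ := exists_setC_eq_nor hr hw hY (i, j)
      exact (hall (i, j) q hq hqn).trans
        (hall (i', j') q hq (hqn.trans (nor_eq_of_wordEq h))).symm
    have h0 := hB.map_eq_zero (T := K.ringCon.Quotient) (π := π) hr hd hπ ha
    exact hmem.1 h0

/-- No proper subset of the relations `γ_p` generates the same ideal. -/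
theorem span_ne_span_kernelRelations (hr : IsSolution r)
    (hw : IsNormalEnumeration k r d w) (hY : IsVeroneseSolution k r w rY)
    {T : Set (YBAlgebra k rY)} (hT : T ⊂ kernelRelations k r w rY) :
    TwoSidedIdeal.span T ≠ TwoSidedIdeal.span (kernelRelations k r w rY) := by
  intro hspan
  obtain ⟨hTs, hTn⟩ := hT
  obtain ⟨z, hz, hzT⟩ := Set.not_subset.1 hTn
  obtain ⟨p, q, h, rfl⟩ := id hz
  let φ := classCoeff k rY [p.1, p.2]
  -- `Z` is the largest two-sided ideal on which `φ` vanishes. It contains every relation except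
  -- `γ_p`, where `φ` takes the value `1`.
  let Z : TwoSidedIdeal (YBAlgebra k rY) := TwoSidedIdeal.mk'
    {f | ∀ a b, φ (a * f * b) = 0} (fun a b => by simp)
    (fun hx hy a b => by rw [mul_add, add_mul, map_add, hx, hy, add_zero])
    (fun hx a b => by rw [mul_neg, neg_mul, map_neg, hx, neg_zero])
    (fun {x y} hy a b => by rw [← mul_assoc a]; exact hy (a * x) b)
    (fun {x y} hx a b => by rw [← mul_assoc a, mul_assoc]; exact hx a (y * b))
  have hZ : ∀ f, f ∈ Z ↔ ∀ a b, φ (a * f * b) = 0 := fun f => TwoSidedIdeal.mem_mk' ..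
  have hle : TwoSidedIdeal.span T ≤ Z := by
    rw [TwoSidedIdeal.span_le]
    intro t ht
    obtain ⟨p', q', h', rfl⟩ := hTs ht
    refine (hZ _).2 (h.classCoeff_mul_mul_of_ne hr hw hY h' ?_)
    rintro rfl
    rw [(existsUnique_isReduction hr hw hY h.1).unique h' h] at ht
    exact hzT ht
  have h1 := (hZ _).1 (hle (hspan ▸ TwoSidedIdeal.subset_span hz)) 1 1
  rw [one_mul, mul_one, h.classCoeff_self hr hw hY] at h1
  exact one_ne_zero h1

end Kernel

/-! ### Counting the relations, and the main theorem -/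

theorem ncard_setMV {k X : Type*} [Field k] [LinearOrder X] [Fintype X] [Nonempty X]
    {r : X × X → X × X} {d N : ℕ} {w : Fin N → List X} {rY : Fin N × Fin N → Fin N × Fin N}
    (hr : IsSolution r) (hw : IsNormalEnumeration k r d w) (hY : IsVeroneseSolution k r w rY) :
    ((setMV k r w).ncard : ℤ) =
      (N + 1).choose 2 - (Fintype.card X + 2 * d - 1).choose (Fintype.card X - 1) := by
  have hsub : setC k r w ⊆ setP k r w := fun p hp => hp.1
  have hMV : setMV k r w = setP k r w \ setC k r w := by
    ext p
    exact ⟨fun h => ⟨h.1, fun h' => h.2 h'.2⟩, fun h => ⟨h.1, fun h' => h.2 ⟨h.1, h'⟩⟩⟩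
  have hP : (setP k r w).ncard = (N + 1).choose 2 := by
    rw [((hY.isBlockSolution hr hw).isSolution hr).ncard_transversal (mem_setP_or hr hw hY)
      fun p h h' => eq_of_mem_setP hr hw hY h h', Fintype.card_fin]
  have hpos := Fintype.card_pos (α := X)
  have hC : (setC k r w).ncard =
      (Fintype.card X + 2 * d - 1).choose (Fintype.card X - 1) := by
    rw [ncard_setC hr hw hY, hr.ncard_normalWords k]
    -- The number of multisets of size `2d` has lower index `2d`; its complement is `n - 1` because
    -- `n ≥ 1`.
    exact (Nat.choose_symm_of_eq_add (by omega)).symm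
  have h := Set.ncard_sdiff_add_ncard_of_subset hsub
  rw [hMV, ← hP, ← hC, ← h]
  push_cast
  ring

theorem mainTheorem2 {k X : Type*} [Field k] [Fintype X] [LinearOrder X] [Nonempty X]
    (r : X × X → X × X) (hr : IsSolution r) (d : ℕ) (hd : 2 ≤ d) (n N : ℕ)
    (hn : n = Fintype.card X) (hN : N = (n + d - 1).choose d) :
    ∃ (w : Fin N → List X) (rY : Fin N × Fin N → Fin N × Fin N),
      IsNormalEnumeration k r d w ∧ IsVeroneseSolution k r w rY ∧ IsSolution rY ∧
      ∃ v : YBAlgebra k rY →ₐ[k] YBAlgebra k r,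
        (∀ i, v (ybWord k rY [i]) = ybWord k r (w i)) ∧
        v.range = veroneseSubalgebra k r d ∧
        (∀ p ∈ setMV k r w, ∃! q, IsReduction k r w p q) ∧
        (∀ p q, IsReduction k r w p q →
          IsLeadingMonomial (wordPoly k [p.1, p.2] - wordPoly k [q.1, q.2]) [p.1, p.2] ∧
          DegLexLT [q.1, q.2] [p.1, p.2]) ∧
        ((setMV k r w).ncard : ℤ) = (N + 1).choose 2 - (n + 2 * d - 1).choose (n - 1) ∧
        ((kernelRelations k r w rY).ncard : ℤ) =
          (N + 1).choose 2 - (n + 2 * d - 1).choose (n - 1) ∧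
        LinearIndepOn k id (kernelRelations k r w rY) ∧
        TwoSidedIdeal.span (kernelRelations k r w rY) = TwoSidedIdeal.ker v ∧
        ∀ T ⊂ kernelRelations k r w rY, TwoSidedIdeal.span T ≠ TwoSidedIdeal.ker v := by
  subst hn
  obtain ⟨w, hw⟩ := hr.exists_isNormalEnumeration (k := k) hN
  obtain ⟨rY, hY⟩ := hw.exists_isVeroneseSolution hr
  have hB := hY.isBlockSolution hr hw
  obtain ⟨i₀, -⟩ := hB.exists_wordEq (List.replicate d (Classical.arbitrary X)) (by simp)
  have : Nonempty (Fin N) := ⟨i₀⟩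
  obtain ⟨g, hg, hrange⟩ := exists_linearIndependent_kernelRelations hr hw hY
  have hcard := ncard_setMV hr hw hY
  refine ⟨w, rY, hw, hY, hB.isSolution hr, hB.veroneseMap k, fun i => ?_, hB.range_veroneseMap,
    fun p hp => existsUnique_isReduction hr hw hY hp,
    fun p q h => ⟨isLeadingMonomial_sub (h.degLexLT hw), h.degLexLT hw⟩, hcard, ?_,
    hrange ▸ hg.linearIndepOn_id, span_kernelRelations hr hd hw hY, fun T hT => ?_⟩
  · simp [hB.veroneseMap_ybWord]
  · rw [← hcard, ← hrange, ← Set.image_univ, hg.injective.injOn.ncard_image, Set.ncard_univ,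
      Nat.card_coe_set_eq]
  · rw [← span_kernelRelations hr hd hw hY]
    exact span_ne_span_kernelRelations hr hw hY hT
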